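/- Let $P$ be a finite set of points of a metric space with distance $d$, and let $k,z$ be integers with $0<k<|P|$ and $0\le z<|P|$. For finite $Q$ and nonempty finite $S$ put $d(p,S)=\min_{q\in S}d(p,q)$ and $\mathrm{cost}(Q,S)=\sum_{p\in Q}d(p,S)^2$; for a weighted set $(T,\mathbf w)$ with positive integer weights put $\mathrm{cost}(T,\mathbf w,S)=\sum_{p\in T}w_p\,d(p,S)^2$. Let $\mathrm{out}_z(P,S)$ be the set of the $z$ points of $P$ farthest from $S$ (ties broken arbitrarily; all of $P$ if $z\ge|P|$). $\mathrm{OPT}_k$ is the minimum of the cost over the nonempty sets $S$ of at most $k$ centers chosen from the given set; in $\mathrm{OPT}_{k,z}(P)$ the cost is $\mathrm{cost}(P\setminus\mathrm{out}_z(P,S),S)$, and in $\mathrm{OPT}_{k,z}(T,\mathbf w)$ it is $\mathrm{cost}(T,\hat{\mathbf w},S)$, where $\hat{\mathbf w}$ is obtained from $\mathbf w$ by progressively subtracting $z$ units of weight from the points farthest from $S$. The doubling dimension $D$ of $P$ is the least $D$ such that every ball of $P$ of radius $r>0$ is contained in at most $2^D$ balls of radius $r/2$ centered in $P$. $\mathrm{CoverWithBalls}(Q,X,\delta,R)$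 repeatedly selects an arbitrary remaining point $q$ of $Q$ and removes all the remaining points $p$ with $d(p,q)\le\delta\max\{R,d(p,X)\}$, for which $q$ is the proxy; it returns the set of the selected points, each weighted by the number (for weighted $Q$: the total weight) of the points whose proxy it is. Let $\rho,\tau,\beta\ge1$ and $\alpha>0$. Let $\rho k$ and $\tau z$ be rounded down where they count points or units of weight, and let $k'=\rho k+\tau z$. Let there be given deterministic sequential $\beta$-approximation algorithms for k-means and for weighted k-means with $k'$ centers, and a sequential $(\rho,\tau)$-bicriteria $\alpha$-approximation algorithm for weighted k-means with $z$ outliers, which on $(T,\mathbf w)$ returns a nonempty set $S\subseteq T$ of at most $\rho k$ centers such that $\mathrm{cost}(T,\hat{\mathbf w},S)\le\alpha\cdot\mathrm{OPT}_{k,z}(T,\mathbf w)$, where $\hat{\mathbf w}$ is obtained by subtracting $\tau z$ units of weight from the points farthest from $S$. Suppose that each of the three runs in working space at most $s\ge0$ times the number of points of its input. Let $0<\gamma\le(\sqrt3-\sqrt2)/6$ and $\delta=\gamma/\sqrt{2\beta}$, and consider the following 3-round MapReduce algorithm. Round 1: $P$ is partitioned evenly into $L=\lceil(|P|/(\rho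 k+\tau z))^{1/2}\rceil$ blocks $P_1,\dots,P_L$ (of sizes $\lfloor|P|/L\rfloor$ or $\lceil|P|/L\rceil$). For each $i$ a reducer computes $S_i\subseteq P_i$ with the k-means algorithm with $k'$ centers, $R_i=\sqrt{\mathrm{cost}(P_i,S_i)/|P_i|}$ and the weighted set $(C_i,\mathbf w^{C_i})=\mathrm{CoverWithBalls}(P_i,S_i,\delta,R_i)$. Round 2: the reducer in charge of $P_i$ receives $P_i$ and all $(|P_j|,R_j,C_j,\mathbf w^{C_j})$. It sets $R=\sqrt{\sum_j|P_j|R_j^2/|P|}$ and $(C,\mathbf w^C)=\bigcup_j(C_j,\mathbf w^{C_j})$, computes $S_C\subseteq C$ with the weighted k-means algorithm with $k'$ centers on $(C,\mathbf w^C)$, then the set $C'$ returned by $\mathrm{CoverWithBalls}$ on $(C,\mathbf w^C),S_C,\delta,R$ (the same $C'$ in all reducers), and outputs the weighted set $(T_i,\mathbf w^{T_i})=\mathrm{CoverWithBalls}(P_i,C',\delta,R)$. Round 3: one reducer gathers $(T,\mathbf w^T)=\bigcup_i(T_i,\mathbf w^{T_i})$ and runs on it the sequential algorithm for weighted k-means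 with outliers, with parameters $k,z$. There are absolute constants $c_1,c_2>0$ such that, in all these cases, the algorithm returns a nonempty set $S\subseteq P$ of at most $\rho k$ centers with $$\mathrm{cost}(P\setminus\mathrm{out}_{\tau z}(P,S),S)\le\bigl(\alpha+c_1(1+\alpha)\gamma\bigr)\cdot\mathrm{OPT}_{k,z}(P),$$ and its local memory, that is, the maximum number of words (a point or a number counts as one word) used by an individual execution of a map function or of a reducer, including its input, its working storage and its output, is at most $$c_2(1+s)\,|P|^{1/2}(\rho k+\tau z)^{1/2}\,\bigl(8\sqrt{2\beta}/\gamma\bigr)^{2D}\log^2|P| .$$ -/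

import Mathlib

open scoped Classical

noncomputable section

namespace KMeansOutliers

/-! ### Costs and optima -/

section Costs

variable {M : Type*} [MetricSpace M]

/-- The distance `d(p, S)`; for a finite nonempty `S` it is the minimum of `dist p q`, `q ∈ S`. -/
def distTo (p : M) (S : Finset M) : ℝ := Metric.infDist p (S : Set M)

/-- `cost(P, S) = ∑_{p ∈ P} d(p, S)²`. -/
def cost (P S : Finset M) : ℝ := ∑ p ∈ P, distTo p S ^ 2

/-- A feasible set of centers for the ground set `Q`: a nonempty set of at most `k` points
of `Q`. -/
def IsCenters (Q : Finset M) (k : ℕ) (S : Finset M) : Prop :=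
  S ⊆ Q ∧ S.Nonempty ∧ S.card ≤ k

/-- The optimal cost `OPT_k(P)` of k-means. -/
def optKMeans (k : ℕ) (P : Finset M) : ℝ :=
  sInf {c | ∃ S, IsCenters P k S ∧ c = cost P S}

/-- `Z` is a possible value of `out_z(P, S)`: it consists of `z` points of `P` farthest from
`S`, ties being broken arbitrarily (all of `P` if `z` exceeds `|P|`). -/
def IsOut (P S : Finset M) (z : ℕ) (Z : Finset M) : Prop :=
  Z ⊆ P ∧ Z.card = min z P.card ∧ ∀ p ∈ Z, ∀ q ∈ P \ Z, distTo q S ≤ distTo p S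

/-- The optimal cost `OPT_{k,z}(P)` of k-means with `z` outliers. -/
def optOut (k z : ℕ) (P : Finset M) : ℝ :=
  sInf {c | ∃ S Z, IsCenters P k S ∧ IsOut P S z Z ∧ c = cost (P \ Z) S}

/-! A weighted set `(T, w)` with positive integer weights is a finitely supported function
`w : M →₀ ℕ`, with `T = w.support`. -/

/-- The set `Q` with all weights equal to one. -/
def unitWeights (Q : Finset M) : M →₀ ℕ := ∑ p ∈ Q, Finsupp.single p 1

/-- The total weight. -/
def totalWeight (w : M →₀ ℕ) : ℕ := w.sum fun _ m => m

/-- `cost(T, w, S) = ∑_{p ∈ T} w_p d(p, S)²`. -/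
def wcost (w : M →₀ ℕ) (S : Finset M) : ℝ := w.sum fun p m => (m : ℝ) * distTo p S ^ 2

/-- The optimal cost `OPT_k(T, w)` of weighted k-means. -/
def optWKMeans (k : ℕ) (w : M →₀ ℕ) : ℝ :=
  sInf {c | ∃ S, IsCenters w.support k S ∧ c = wcost w S}

/-- `w'` is obtained from `w` by progressively reducing the weights of the points farthest from
`S` until exactly `z` units (everything if `z` exceeds the total weight) are subtracted, ties
being broken arbitrarily: a point loses weight only if all strictly farther points have lost
all of theirs. -/
def IsScaled (w : M →₀ ℕ) (S : Finset M) (z : ℕ) (w' : M →₀ ℕ) : Prop :=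
  (∀ p, w' p ≤ w p) ∧
  totalWeight w' + min z (totalWeight w) = totalWeight w ∧
  ∀ p q, w' p < w p → distTo p S < distTo q S → w' q = 0

/-- The optimal cost `OPT_{k,z}(T, w)` of weighted k-means with `z` outliers. -/
def optWOut (k z : ℕ) (w : M →₀ ℕ) : ℝ :=
  sInf {c | ∃ S w', IsCenters w.support k S ∧ IsScaled w S z w' ∧ c = wcost w' S}

/-- Every ball of `P` of radius `r > 0` is contained in the union of at most `2 ^ D` balls of
radius `r / 2` centered at points of `P`. -/
def IsDoubling (P : Finset M) (D : ℝ) : Prop :=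
  ∀ p ∈ P, ∀ r : ℝ, 0 < r → ∃ F ⊆ P, (F.card : ℝ) ≤ (2 : ℝ) ^ D ∧
    ∀ x ∈ P, dist x p ≤ r → ∃ y ∈ F, dist x y ≤ r / 2

/-- The doubling dimension of `P`: the smallest `D` with the property above. -/
def doublingDim (P : Finset M) : ℝ := sInf {D | IsDoubling P D}

end Costs

/-! ### Sequential subroutines -/

/-- A sequential algorithm: what it returns, and its working space (in words). -/
structure SeqAlg (I O : Type*) where
  run : I → O
  space : I → ℕ

section Sequential

variable {M : Type*} [MetricSpace M]

/-- `A` is a `β`-approximation for k-means with `k` centers, on all nonempty subsets of `P`. -/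
def IsKMeansApprox (P : Finset M) (β : ℝ) (k : ℕ) (A : SeqAlg (Finset M × ℕ) (Finset M)) : Prop :=
  ∀ Q ⊆ P, Q.Nonempty →
    IsCenters Q k (A.run (Q, k)) ∧ cost Q (A.run (Q, k)) ≤ β * optKMeans k Q

/-- `A` is a `β`-approximation for weighted k-means with `k` centers, on all nonempty weighted
subsets of `P`. -/
def IsWKMeansApprox (P : Finset M) (β : ℝ) (k : ℕ)
    (A : SeqAlg ((M →₀ ℕ) × ℕ) (Finset M)) : Prop :=
  ∀ w : M →₀ ℕ, w.support ⊆ P → w.support.Nonempty →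
    IsCenters w.support k (A.run (w, k)) ∧ wcost w (A.run (w, k)) ≤ β * optWKMeans k w

/-- `A` is a `(ρ, τ)`-bicriteria `α`-approximation for weighted k-means with `z` outliers and `k`
centers, on all weighted subsets of `P` of total weight more than `z`: it returns at most `ρ k`
centers, and after subtracting `τ z` units of weight from the points farthest from these, the
cost is at most `α` times the optimum for `k` centers and `z` outliers. -/
def IsBicriteriaApprox (P : Finset M) (ρ τ α : ℝ) (k z : ℕ)
    (A : SeqAlg ((M →₀ ℕ) × ℕ × ℕ) (Finset M)) : Prop :=
  ∀ w : M →₀ ℕ, w.support ⊆ P → z < totalWeight w →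
    IsCenters w.support ⌊ρ * k⌋₊ (A.run (w, k, z)) ∧
    ∀ w', IsScaled w (A.run (w, k, z)) ⌊τ * z⌋₊ w' →
      wcost w' (A.run (w, k, z)) ≤ α * optWOut k z w

/-! ### CoverWithBalls -/

/-- A rule for the arbitrary selection of a point from the set of the remaining points. -/
abbrev Selector (M : Type*) := (Q : Finset M) → Q.Nonempty → {q : M // q ∈ Q}

/-- The points of `Q` that are removed when `q` is selected; they get `q` as their proxy.
(For `δ, R ≥ 0` the first alternative, which makes the procedure terminate in every case,
is implied by the second.) -/
def coveredBy (X : Finset M) (δ R : ℝ) (Q : Finset M) (q : M) : Finset M :=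
  Q.filter fun p => p = q ∨ dist p q ≤ δ * max R (distTo p X)

/-- The loop of `CoverWithBalls`, on the set `Q` of the remaining points. -/
def coverLoop (sel : Selector M) (w : M →₀ ℕ) (X : Finset M) (δ R : ℝ) (Q : Finset M) : M →₀ ℕ :=
  if h : Q.Nonempty then
    Finsupp.single (sel Q h : M) (∑ p ∈ coveredBy X δ R Q (sel Q h), w p) +
      coverLoop sel w X δ R (Q \ coveredBy X δ R Q (sel Q h))
  else 0
termination_by Q.card
decreasing_by
  apply Finset.card_lt_card
  refine Finset.ssubset_iff_of_subset Finset.sdiff_subset |>.2 ⟨_, (sel Q h).2, ?_⟩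
  simp [coveredBy, (sel Q h).2]

/-- `CoverWithBalls`, on a weighted set of points: the weight of each `q` in the returned set is
the total weight of the points that have `q` as their proxy. -/
def coverWithBalls (sel : Selector M) (w : M →₀ ℕ) (X : Finset M) (δ R : ℝ) : M →₀ ℕ :=
  coverLoop sel w X δ R w.support

/-- Memory words of a weighted set: a point and a weight for each element. -/
def wsetWords (w : M →₀ ℕ) : ℕ := 2 * w.support.card

/-- Working space of `CoverWithBalls`: the weighted set of the remaining points, the set `X`,
the two numbers `δ, R`, and the weighted set under construction. -/
def coverSpace (w : M →₀ ℕ) (X : Finset M) (Y : M →₀ ℕ) : ℕ :=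
  wsetWords w + X.card + 2 + wsetWords Y

end Sequential

/-! ### MapReduce -/

/-- A MapReduce round. Keys are natural numbers. `inWords`, `midWords`, `outWords` give the
numbers of memory words of the values. The reduce function gives the output pairs together with
the number of words of its working storage, in addition to its input and its output. -/
structure Round (V V' V'' : Type*) where
  map : ℕ × V → Multiset (ℕ × V')
  reduce : ℕ → Multiset V' → Multiset (ℕ × V'') × ℕ
  inWords : V → ℕ
  midWords : V' → ℕ
  outWords : V'' → ℕ

namespace Round

variable {V V' V'' : Type*} (r : Round V V' V'')

/-- The pairs produced by the map phase. -/
def mapped (X : Multiset (ℕ × V)) : Multiset (ℕ × V') := X.bind r.map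

/-- The keys occurring after the map phase; there is one reducer for each. -/
def keys (X : Multiset (ℕ × V)) : Finset ℕ := ((r.mapped X).map Prod.fst).toFinset

/-- The values that the map phase sends to the reducer in charge of `i`. -/
def group (X : Multiset (ℕ × V)) (i : ℕ) : Multiset V' :=
  ((r.mapped X).filter fun x => x.1 = i).map Prod.snd

/-- The output of the round. -/
def run (X : Multiset (ℕ × V)) : Multiset (ℕ × V'') :=
  ∑ i ∈ r.keys X, (r.reduce i (r.group X i)).1

/-- Memory used by the map function on one pair: its input and its output. -/
def mapMemory (x : ℕ × V) : ℕ :=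
  (1 + r.inWords x.2) + ((r.map x).map fun y => 1 + r.midWords y.2).sum

/-- Memory used by one reducer: its key, its input, its working storage and its output. -/
def reduceMemory (i : ℕ) (vs : Multiset V') : ℕ :=
  1 + (vs.map r.midWords).sum + (r.reduce i vs).2 +
    ((r.reduce i vs).1.map fun y => 1 + r.outWords y.2).sum

/-- The local memory of the round: the maximum memory used by an individual execution of the
map function or of a reducer. -/
def localMemory (X : Multiset (ℕ × V)) : ℕ :=
  max (X.toFinset.sup r.mapMemory) ((r.keys X).sup fun i => r.reduceMemory i (r.group X i))

end Round

/-! ### The 3-round algorithm -/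

section Algorithm

variable {M : Type*} [MetricSpace M]

/-- What the first round computes on a block: its size, its radius and its weighted cover. -/
structure Summary (M : Type*) where
  size : ℕ
  radius : ℝ
  cover : M →₀ ℕ

/-- The values exchanged between the first two rounds: points and summaries. -/
abbrev Msg (M : Type*) := M ⊕ Summary M

/-- Memory words of a message. -/
def msgWords : Msg M → ℕ
  | Sum.inl _ => 1
  | Sum.inr s => 2 + wsetWords s.cover

/-- What the algorithm is given, besides the set of points: the number `L` of blocks, the map
`block` that assigns points to blocks, the number `k'` of centers for the first two rounds,
the numbers `k`, `z` for the last round, the precision `δ` of `CoverWithBalls`, the sequential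
subroutines and the selection rules of the calls of `CoverWithBalls`. -/
structure Setup (M : Type*) where
  L : ℕ
  block : M → ℕ
  k' : ℕ
  k : ℕ
  z : ℕ
  δ : ℝ
  seqKMeans : SeqAlg (Finset M × ℕ) (Finset M)
  seqWKMeans : SeqAlg ((M →₀ ℕ) × ℕ) (Finset M)
  seqWKMeansOut : SeqAlg ((M →₀ ℕ) × ℕ × ℕ) (Finset M)
  sel₁ : ℕ → Selector M
  selC : Selector M
  sel₂ : ℕ → Selector M

/-- Round 1. The points are distributed to `L` reducers. The reducer of the block `Q` computes
centers `S`, the radius `R = √(cost(Q, S) / |Q|)` and the weighted cover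
`C = CoverWithBalls(Q, S, δ, R)`, and outputs the points of the block and its summary. -/
def round1 (a : Setup M) : Round M M (Msg M) where
  map x := {(a.block x.2, x.2)}
  reduce i vs :=
    let Q := vs.toFinset
    let S := a.seqKMeans.run (Q, a.k')
    let R := √(cost Q S / Q.card)
    let C := coverWithBalls (a.sel₁ i) (unitWeights Q) S a.δ R
    (Q.val.map (fun p => (i, Sum.inl p)) + {(i, Sum.inr ⟨Q.card, R, C⟩)},
      a.seqKMeans.space (Q, a.k') + S.card + coverSpace (unitWeights Q) S C)
  inWords _ := 1
  midWords _ := 1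
  outWords := msgWords

/-- Round 2. The points stay in their blocks and every reducer receives all summaries. The
reducer of the block `Q` computes the global radius `R` and the union `C` of the weighted covers,
centers `SC` for weighted k-means on `C`, the second-level cover
`C' = CoverWithBalls(C, SC, δ, R)`, and the weighted set `T = CoverWithBalls(Q, C', δ, R)`,
whose weighted points it outputs. -/
def round2 (a : Setup M) : Round (Msg M) (Msg M) (M × ℕ) where
  map x :=
    match x with
    | (i, Sum.inl p) => {(i, Sum.inl p)}
    | (_, Sum.inr s) => (Multiset.range a.L).map fun i => (i, Sum.inr s)
  reduce i vs :=
    let Q := (vs.filterMap Sum.getLeft?).toFinset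
    let sums := vs.filterMap Sum.getRight?
    let N := (sums.map Summary.size).sum
    let R := √((sums.map fun s => (s.size : ℝ) * s.radius ^ 2).sum / N)
    let C := (sums.map Summary.cover).sum
    let SC := a.seqWKMeans.run (C, a.k')
    let C' := coverWithBalls a.selC C SC a.δ R
    let T := coverWithBalls (a.sel₂ i) (unitWeights Q) C'.support a.δ R
    (T.support.val.map (fun q => (0, (q, T q))),
      2 + wsetWords C + a.seqWKMeans.space (C, a.k') + SC.card + coverSpace C SC C' +
        coverSpace (unitWeights Q) C'.support T)
  inWords := msgWords
  midWords := msgWords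
  outWords _ := 2

/-- Round 3. A single reducer gathers the weighted set `(T, w)` and runs the sequential algorithm
for weighted k-means with outliers on it. -/
def round3 (a : Setup M) : Round (M × ℕ) (M × ℕ) M where
  map x := {x}
  reduce _ vs :=
    let w := (vs.map fun x => Finsupp.single x.1 x.2).sum
    let S := a.seqWKMeansOut.run (w, a.k, a.z)
    (S.val.map (fun p => (0, p)),
      wsetWords w + a.seqWKMeansOut.space (w, a.k, a.z) + S.card)
  inWords _ := 2
  midWords _ := 2
  outWords _ := 1

/-- The input of the first round. -/
def input (P : Finset M) : Multiset (ℕ × M) := P.val.map fun p => (0, p)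

/-- The output of the first round. -/
def afterRound1 (a : Setup M) (P : Finset M) : Multiset (ℕ × Msg M) := (round1 a).run (input P)

/-- The output of the second round. -/
def afterRound2 (a : Setup M) (P : Finset M) : Multiset (ℕ × (M × ℕ)) :=
  (round2 a).run (afterRound1 a P)

/-- The set of centers returned by the algorithm. -/
def solution (a : Setup M) (P : Finset M) : Finset M :=
  (((round3 a).run (afterRound2 a P)).map Prod.snd).toFinset

/-- The local memory of the algorithm: the maximum over its three rounds. -/
def localMemory (a : Setup M) (P : Finset M) : ℕ :=
  max ((round1 a).localMemory (input P))
    (max ((round2 a).localMemory (afterRound1 a P)) ((round3 a).localMemory (afterRound2 a P)))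

/-- `block` partitions `P` evenly into `L` blocks. -/
def IsEvenPartition (P : Finset M) (L : ℕ) (block : M → ℕ) : Prop :=
  (∀ p ∈ P, block p < L) ∧
  ∀ i < L, P.card / L ≤ (P.filter fun p => block p = i).card ∧
    (P.filter fun p => block p = i).card ≤ (P.card + L - 1) / L

/-- The setup is the one prescribed for the input `P`, the parameters `ρ, τ, β, γ` and the given
`k, z`: `k' = ρk + τz`, `δ = γ / √(2β)`, and `P` is split evenly into
`L = (|P| / (ρk + τz))^{1/2}` blocks, all with the necessary rounding. -/
structure IsSetupFor (a : Setup M) (P : Finset M) (ρ τ β γ : ℝ) (k z : ℕ) : Prop where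
  k_eq : a.k = k
  z_eq : a.z = z
  k'_eq : a.k' = ⌊ρ * k⌋₊ + ⌊τ * z⌋₊
  δ_eq : a.δ = γ / √(2 * β)
  L_eq : a.L = ⌈√((P.card : ℝ) / (ρ * k + τ * z))⌉₊
  even : IsEvenPartition P a.L a.block

/-- On inputs contained in `P`, the sequential subroutines run in working space at most `s` times
the number of points of their input. -/
structure HasLinearSpace (a : Setup M) (P : Finset M) (s : ℝ) : Prop where
  kMeans : ∀ Q ⊆ P, Q.Nonempty → (a.seqKMeans.space (Q, a.k') : ℝ) ≤ s * Q.card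
  wKMeans : ∀ w : M →₀ ℕ, w.support ⊆ P → w.support.Nonempty →
    (a.seqWKMeans.space (w, a.k') : ℝ) ≤ s * w.support.card
  wKMeansOut : ∀ w : M →₀ ℕ, w.support ⊆ P → a.z < totalWeight w →
    (a.seqWKMeansOut.space (w, a.k, a.z) : ℝ) ≤ s * w.support.card

end Algorithm

end KMeansOutliers

end

open KMeansOutliers

/-! Write O for the optimum with outliers. Opening a center at each of the z outliers of an optimal
solution makes them free, so k + z ≤ k' centers serve all of P at cost at most O (`cost_union_le`).
Ordinary k-means with k' centers is therefore controlled by O, up to the factor β and a factor 4 for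
forcing centers into a block or a cover. Hence |P|R² ≤ 4βO (`IsRegular.globalRadius_sq_le`). The
choice 2βδ² = γ² cancels β: the first-level proxies have total squared displacement at most 4γ²O,
the second-level cover satisfies cost(P, C') ≤ O (`cost_cover_le`), and the final proxies have total
squared displacement at most 3γ²O.

A squared displacement of order γ²O changes a cost by a factor 1 + γ and an additive term of order
γO (`sum_add_sq_le`). This transfers solutions between P and the coreset T in both directions
(`cost_sdiff_le_of_proxies`). Optimal centers need not lie in T, so they are replaced by their
proxies. A center and the points it serves may lie in different blocks, but R and C' are common to
all blocks, so the triangle inequality bounds the displacement of the center by quantities attached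
to the points served.

For the memory, points selected by `CoverWithBalls` are far apart relative to their distance from
the reference set, so doubling allows at most (8/δ)^D of them per center and dyadic ring
(`IsSeparated.card_le`). There are J ≈ log |P| rings, since a single distance squared is at most the
whole cost. The second level squares the factor J(8/δ)^D (`card_le_of_separated_twice`). The choice
of L balances the block size |P|/L against Lk', both of order (|P|(ρk + τz))^{1/2}. -/

noncomputable section

namespace KMeansOutliers

/-! ### Distances to center sets, costs and optima -/

section Basics

variable {M : Type*} [MetricSpace M]

lemma distTo_nonneg (p : M) (S : Finset M) : 0 ≤ distTo p S := Metric.infDist_nonneg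

lemma distTo_le_dist (p : M) {q : M} {S : Finset M} (hq : q ∈ S) : distTo p S ≤ dist p q :=
  Metric.infDist_le_dist_of_mem (by simpa using hq)

lemma distTo_le_add (p q : M) (S : Finset M) : distTo p S ≤ dist p q + distTo q S := by
  rw [add_comm]; exact Metric.infDist_le_infDist_add_dist

lemma exists_distTo_eq (p : M) {S : Finset M} (hS : S.Nonempty) :
    ∃ q ∈ S, distTo p S = dist p q := by
  obtain ⟨q, hq, h⟩ := S.finite_toSet.isCompact.exists_infDist_eq_dist (by simpa using hS) p
  exact ⟨q, by simpa using hq, h⟩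

lemma cost_nonneg (P S : Finset M) : 0 ≤ cost P S := Finset.sum_nonneg fun _ _ => sq_nonneg _

lemma wcost_nonneg (w : M →₀ ℕ) (S : Finset M) : 0 ≤ wcost w S :=
  Finset.sum_nonneg fun _ _ => by positivity

/-- Centers chosen in `Q` cost at most twice the distance of arbitrary centers. -/
lemma exists_centers_distTo_le {Q S : Finset M} {k : ℕ} (hQ : Q.Nonempty) (hS : S.Nonempty)
    (hk : S.card ≤ k) :
    ∃ X, IsCenters Q k X ∧ ∀ p ∈ Q, distTo p X ≤ 2 * distTo p S := by
  choose f hf hfd using fun s : M => exists_distTo_eq s hQ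
  refine ⟨S.image f, ⟨?_, hS.image f, Finset.card_image_le.trans hk⟩, fun p hp => ?_⟩
  · intro x hx
    obtain ⟨s, -, rfl⟩ := Finset.mem_image.1 hx
    exact hf s
  · obtain ⟨s, hs, hps⟩ := exists_distTo_eq p hS
    have h1 := distTo_le_dist p (Finset.mem_image_of_mem f hs)
    have h2 := dist_triangle p s (f s)
    have h3 := distTo_le_dist s hp
    rw [hfd s, dist_comm s p] at h3
    linarith

lemma optKMeans_le {k : ℕ} {P S : Finset M} (h : IsCenters P k S) : optKMeans k P ≤ cost P S :=
  csInf_le ⟨0, by rintro _ ⟨S, -, rfl⟩; exact cost_nonneg _ _⟩ ⟨S, h, rfl⟩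

lemma optWKMeans_le {k : ℕ} {w : M →₀ ℕ} {S : Finset M} (h : IsCenters w.support k S) :
    optWKMeans k w ≤ wcost w S :=
  csInf_le ⟨0, by rintro _ ⟨S, -, rfl⟩; exact wcost_nonneg _ _⟩ ⟨S, h, rfl⟩

lemma optWOut_le {k z : ℕ} {w w' : M →₀ ℕ} {S : Finset M} (h : IsCenters w.support k S)
    (hw : IsScaled w S z w') : optWOut k z w ≤ wcost w' S :=
  csInf_le ⟨0, by rintro _ ⟨S, w', -, -, rfl⟩; exact wcost_nonneg _ _⟩ ⟨S, w', h, hw, rfl⟩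

/-- The comparison set need not lie in `Q`: moving its centers into `Q` doubles distances, hence the
4 after squaring. -/
lemma optKMeans_le_four_mul {k : ℕ} {Q S : Finset M} (hQ : Q.Nonempty) (hS : S.Nonempty)
    (hk : S.card ≤ k) : optKMeans k Q ≤ 4 * cost Q S := by
  obtain ⟨X, hX, h⟩ := exists_centers_distTo_le hQ hS hk
  refine (optKMeans_le hX).trans ?_
  rw [cost, cost, Finset.mul_sum]
  refine Finset.sum_le_sum fun p hp => ?_
  have := h p hp
  have := distTo_nonneg p X
  nlinarith

lemma optWKMeans_le_four_mul {k : ℕ} {w : M →₀ ℕ} {S : Finset M} (hw : w.support.Nonempty)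
    (hS : S.Nonempty) (hk : S.card ≤ k) : optWKMeans k w ≤ 4 * wcost w S := by
  obtain ⟨X, hX, h⟩ := exists_centers_distTo_le hw hS hk
  refine (optWKMeans_le hX).trans ?_
  rw [wcost, wcost, Finsupp.sum, Finsupp.sum, Finset.mul_sum]
  refine Finset.sum_le_sum fun p hp => ?_
  have h1 := h p hp
  have h2 := distTo_nonneg p X
  have h3 : (0 : ℝ) ≤ w p := by positivity
  have h4 : distTo p X ^ 2 ≤ 4 * distTo p S ^ 2 := by nlinarith
  nlinarith

end Basics

/-! ### Farthest points -/

section Top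

variable {α : Type*}

lemma exists_farthest (P : Finset α) (f : α → ℝ) {z : ℕ} (hz : z ≤ P.card) :
    ∃ Z ⊆ P, Z.card = z ∧ ∀ p ∈ Z, ∀ q ∈ P \ Z, f q ≤ f p := by
  induction z with
  | zero => exact ⟨∅, by simp, rfl, by simp⟩
  | succ z ih =>
    obtain ⟨Z, hZ, hc, h⟩ := ih (by omega)
    have hne : (P \ Z).Nonempty := by
      rw [← Finset.card_pos, Finset.card_sdiff_of_subset hZ]; omega
    obtain ⟨x, hx, hmax⟩ := (P \ Z).exists_max_image f hne
    have hx' := Finset.mem_sdiff.1 hx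
    refine ⟨insert x Z, Finset.insert_subset hx'.1 hZ, ?_, ?_⟩
    · rw [Finset.card_insert_of_notMem hx'.2, hc]
    · intro p hp q hq
      simp only [Finset.mem_sdiff, Finset.mem_insert, not_or] at hq
      have hq' : q ∈ P \ Z := by simp [hq]
      rcases Finset.mem_insert.1 hp with rfl | hp
      · exact hmax q hq'
      · exact h p hp q hq'

/-- Exchange argument: apart from the common terms, the sums range over `Z' \ Z` and `Z \ Z'`. The
first set is no larger, and each of its values is at most the minimum of `f` on the second. -/
lemma sum_sdiff_farthest_le {P Z Z' : Finset α} {f : α → ℝ} (hf : ∀ p, 0 ≤ f p) (hZ : Z ⊆ P)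
    (hZ' : Z' ⊆ P) (hc : Z'.card ≤ Z.card) (h : ∀ p ∈ Z, ∀ q ∈ P \ Z, f q ≤ f p) :
    ∑ p ∈ P \ Z, f p ^ 2 ≤ ∑ p ∈ P \ Z', f p ^ 2 := by
  have e1 : ∑ p ∈ P \ Z, f p ^ 2 =
      ∑ p ∈ P \ (Z ∪ Z'), f p ^ 2 + ∑ p ∈ Z' \ Z, f p ^ 2 := by
    rw [← Finset.sum_union]
    · congr 1; ext x; have := @hZ' x; simp; tauto
    · rw [Finset.disjoint_left]; intro x; simp; tauto
  have e2 : ∑ p ∈ P \ Z', f p ^ 2 =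
      ∑ p ∈ P \ (Z ∪ Z'), f p ^ 2 + ∑ p ∈ Z \ Z', f p ^ 2 := by
    rw [← Finset.sum_union]
    · congr 1; ext x; have := @hZ x; simp; tauto
    · rw [Finset.disjoint_left]; intro x; simp; tauto
  rw [e1, e2]
  gcongr 1
  have hcard : (Z' \ Z).card ≤ (Z \ Z').card := by
    have h1 := Finset.card_sdiff_add_card_inter Z Z'
    have h2 := Finset.card_sdiff_add_card_inter Z' Z
    rw [Finset.inter_comm] at h2; omega
  rcases (Z \ Z').eq_empty_or_nonempty with h0 | h0
  · rw [h0, Finset.card_empty, Nat.le_zero, Finset.card_eq_zero] at hcard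
    rw [h0, hcard]
  obtain ⟨x, hx, hmin⟩ := (Z \ Z').exists_min_image f h0
  calc ∑ p ∈ Z' \ Z, f p ^ 2 ≤ ∑ p ∈ Z' \ Z, f x ^ 2 := by
        refine Finset.sum_le_sum fun p hp => ?_
        have hp' := Finset.mem_sdiff.1 hp
        exact pow_le_pow_left₀ (hf p) (h x (Finset.mem_sdiff.1 hx).1 p
          (Finset.mem_sdiff.2 ⟨hZ' hp'.1, hp'.2⟩)) 2
    _ ≤ ∑ p ∈ Z \ Z', f x ^ 2 := by
        simp only [Finset.sum_const, nsmul_eq_mul]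
        have : ((Z' \ Z).card : ℝ) ≤ (Z \ Z').card := by exact_mod_cast hcard
        gcongr
    _ ≤ ∑ p ∈ Z \ Z', f p ^ 2 :=
        Finset.sum_le_sum fun p hp => pow_le_pow_left₀ (hf x) (hmin p hp) 2

end Top

/-! ### Images of sets of points as weighted sets -/

section Push

variable {M : Type*}

/-- The weighted set of the images under `π` of the points of `P`. -/
def push (P : Finset M) (π : M → M) : M →₀ ℕ := ∑ p ∈ P, Finsupp.single (π p) 1

lemma push_apply (P : Finset M) (π : M → M) (q : M) :
    push P π q = (P.filter fun p => π p = q).card := by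
  rw [push, Finsupp.finsetSum_apply, Finset.card_filter]
  exact Finset.sum_congr rfl fun p _ => Finsupp.single_apply

lemma support_push (P : Finset M) (π : M → M) : (push P π).support = P.image π := by
  ext q
  simp [push_apply, Finset.filter_eq_empty_iff]

lemma totalWeight_push (P : Finset M) (π : M → M) : totalWeight (push P π) = P.card := by
  unfold totalWeight push
  rw [← Finsupp.sum_finsetSum_index (fun _ => rfl) (fun _ _ _ => rfl)]
  simp

lemma unitWeights_eq_push [MetricSpace M] (P : Finset M) : unitWeights P = push P id := rfl

lemma wcost_push [MetricSpace M] (P : Finset M) (π : M → M) (S : Finset M) :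
    wcost (push P π) S = ∑ p ∈ P, distTo (π p) S ^ 2 := by
  unfold wcost push
  rw [← Finsupp.sum_finsetSum_index (by simp) (by intros; push_cast; ring)]
  simp

/-- Removing the points with the farthest images is a way of progressively subtracting
weight. -/
lemma isScaled_push [MetricSpace M] {P Z S : Finset M} {π : M → M} {z : ℕ} (hZ : Z ⊆ P)
    (hc : Z.card = min z P.card)
    (h : ∀ p ∈ Z, ∀ q ∈ P \ Z, distTo (π q) S ≤ distTo (π p) S) :
    IsScaled (push P π) S z (push (P \ Z) π) := by
  refine ⟨fun p => ?_, ?_, fun p q hp hpq => ?_⟩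
  · rw [push_apply, push_apply]
    exact Finset.card_le_card (Finset.filter_subset_filter _ Finset.sdiff_subset)
  · rw [totalWeight_push, totalWeight_push, Finset.card_sdiff_of_subset hZ]
    have := Finset.card_le_card hZ
    omega
  · rw [push_apply, push_apply] at hp
    obtain ⟨x, hx, hx'⟩ := Finset.exists_mem_notMem_of_card_lt_card hp
    simp only [Finset.mem_filter, Finset.mem_sdiff, not_and] at hx hx'
    have hxZ : x ∈ Z := by
      by_contra hxZ
      exact hx' ⟨hx.1, hxZ⟩ hx.2
    rw [push_apply, Finset.card_eq_zero, Finset.filter_eq_empty_iff]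
    rintro y hy rfl
    have := h x hxZ y hy
    rw [hx.2] at this
    linarith

end Push

/-! ### Doubling dimension and packing -/

section Doubling

variable {M : Type*} [MetricSpace M]

lemma IsDoubling.nonneg {P : Finset M} (hP : P.Nonempty) {D : ℝ} (h : IsDoubling P D) :
    0 ≤ D := by
  obtain ⟨p, hp⟩ := hP
  obtain ⟨F, -, hc, hF⟩ := h p hp 1 one_pos
  obtain ⟨y, hy, -⟩ := hF p hp (by simp)
  have h1 : (1 : ℝ) ≤ F.card := by
    exact_mod_cast Finset.card_pos.2 ⟨y, hy⟩
  by_contra hD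
  have := Real.rpow_lt_one_of_one_lt_of_neg one_lt_two (not_le.1 hD)
  linarith

/-- Makes the set of admissible dimensions nonempty, so that its infimum is meaningful. -/
lemma isDoubling_card (P : Finset M) : IsDoubling P P.card := by
  intro p _ r hr
  refine ⟨P, subset_rfl, ?_, fun x hx _ => ⟨x, hx, by simp; positivity⟩⟩
  rw [Real.rpow_natCast]
  exact_mod_cast Nat.lt_two_pow_self.le

/-- The infimum in the definition of the doubling dimension is attained. -/
lemma isDoubling_doublingDim (P : Finset M) : IsDoubling P (doublingDim P) := by
  intro p hp r hr
  set A : Set (Finset M) := {F | F ⊆ P ∧ ∀ x ∈ P, dist x p ≤ r → ∃ y ∈ F, dist x y ≤ r / 2}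
  have hfin : A.Finite :=
    P.powerset.finite_toSet.subset fun F hF => by simpa using hF.1
  -- A cover of least cardinality does not depend on D. Every admissible D is at least log₂ of its
  -- size, hence so is the infimum.
  obtain ⟨F, hF, hmin⟩ := hfin.exists_minimalFor Finset.card A
    ⟨P, subset_rfl, fun x hx _ => ⟨x, hx, by simp; positivity⟩⟩
  replace hmin : ∀ F' ∈ A, F.card ≤ F'.card := fun F' hF' =>
    (le_total F.card F'.card).elim id (hmin hF')
  refine ⟨F, hF.1, ?_, hF.2⟩
  obtain ⟨y, hy, -⟩ := hF.2 p hp (by simp [hr.le])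
  have hpos : (0 : ℝ) < F.card := by exact_mod_cast Finset.card_pos.2 ⟨y, hy⟩
  rw [← Real.logb_le_iff_le_rpow one_lt_two hpos]
  refine le_csInf ⟨_, isDoubling_card P⟩ fun D hD => ?_
  rw [Real.logb_le_iff_le_rpow one_lt_two hpos]
  obtain ⟨F', hF', hc, h⟩ := hD p hp r hr
  refine le_trans ?_ hc
  exact_mod_cast hmin F' ⟨hF', h⟩

/-- The halving property iterated `t` times; it can be reapplied because the new centers are again
in `P`. -/
lemma IsDoubling.exists_cover {P : Finset M} {D : ℝ} (h : IsDoubling P D) (t : ℕ) {c : M}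
    (hc : c ∈ P) {r : ℝ} (hr : 0 < r) :
    ∃ F ⊆ P, (F.card : ℝ) ≤ ((2 : ℝ) ^ D) ^ t ∧
      ∀ x ∈ P, dist x c ≤ r → ∃ y ∈ F, dist x y ≤ r / 2 ^ t := by
  induction t with
  | zero => exact ⟨{c}, by simpa using hc, by simp, fun x _ hx => ⟨c, by simp, by simpa using hx⟩⟩
  | succ t ih =>
    obtain ⟨F, hFP, hcard, hF⟩ := ih
    have hr' : 0 < r / 2 ^ t := by positivity
    have hex : ∀ y : M, ∃ G ⊆ P, (G.card : ℝ) ≤ (2 : ℝ) ^ D ∧ (y ∈ P → ∀ x ∈ P,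
        dist x y ≤ r / 2 ^ t → ∃ u ∈ G, dist x u ≤ r / 2 ^ t / 2) := by
      intro y
      by_cases hy : y ∈ P
      · obtain ⟨G, h1, h2, h3⟩ := h y hy _ hr'
        exact ⟨G, h1, h2, fun _ => h3⟩
      · exact ⟨∅, by simp, by simp; positivity, fun h => absurd h hy⟩
    choose G hGP hGc hG using hex
    refine ⟨F.biUnion G, Finset.biUnion_subset.2 fun y _ => hGP y, ?_, fun x hx hxc => ?_⟩
    · calc ((F.biUnion G).card : ℝ) ≤ ∑ y ∈ F, ((G y).card : ℝ) := by
            exact_mod_cast Finset.card_biUnion_le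
        _ ≤ ∑ y ∈ F, (2 : ℝ) ^ D := Finset.sum_le_sum fun y _ => hGc y
        _ ≤ ((2 : ℝ) ^ D) ^ (t + 1) := by
            rw [Finset.sum_const, nsmul_eq_mul, pow_succ]
            gcongr
    · obtain ⟨y, hy, hxy⟩ := hF x hx hxc
      obtain ⟨u, hu, hxu⟩ := hG y (hFP hy) x hx hxy
      exact ⟨u, Finset.mem_biUnion.2 ⟨y, hy, hu⟩, by rw [pow_succ, ← div_div]; exact hxu⟩

/-- A ball of radius `2 r` contains few points at pairwise distance more than `δ r`. -/
lemma card_le_of_separated {P : Finset M} {D : ℝ} (hD : IsDoubling P D) {c : M} (hc : c ∈ P)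
    {δ r : ℝ} (hδ : 0 < δ) (hδ1 : δ ≤ 1) (hr : 0 ≤ r) {Y : Finset M} (hYP : Y ⊆ P)
    (hY : ∀ y ∈ Y, dist y c ≤ 2 * r)
    (hsep : ∀ x ∈ Y, ∀ y ∈ Y, x ≠ y → δ * r < dist x y) :
    (Y.card : ℝ) ≤ (8 / δ) ^ D := by
  have hD0 := hD.nonneg ⟨c, hc⟩
  have h8 : 1 ≤ 8 / δ := by rw [le_div_iff₀ hδ]; linarith
  rcases hr.eq_or_lt with rfl | hr
  · refine le_trans ?_ (Real.one_le_rpow h8 hD0)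
    have : Y.card ≤ 1 := by
      refine Finset.card_le_one.2 fun x hx y hy => ?_
      have h1 := hY x hx
      have h2 := hY y hy
      simp only [mul_zero, dist_le_zero] at h1 h2
      rw [h1, h2]
    exact_mod_cast this
  -- With 2^t ≤ 4/δ < 2^(t+1), covering balls of radius 2r/2^(t+1) have diameter at most δr, so each
  -- contains at most one point of `Y`; and 2^(t+1) ≤ 8/δ bounds their number.
  obtain ⟨t, ht1, ht2⟩ := exists_nat_pow_near (x := 4 / δ) (y := 2)
    (by rw [le_div_iff₀ hδ]; linarith) one_lt_two
  obtain ⟨F, hFP, hcard, hF⟩ := hD.exists_cover (t + 1) hc (r := 2 * r) (by positivity)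
  have hsmall : 2 * (2 * r / 2 ^ (t + 1)) ≤ δ * r := by
    rw [div_lt_iff₀ hδ] at ht2
    rw [← mul_div_assoc, div_le_iff₀ (by positivity)]
    nlinarith
  choose! g hg hgd using fun y (hy : y ∈ Y) => hF y (hYP hy) (hY y hy)
  have hYF : Y.card ≤ F.card := by
    refine Finset.card_le_card_of_injOn g hg fun x hx y hy hxy => ?_
    by_contra hne
    have h1 := hsep x hx y hy hne
    have h2 := hgd x hx
    have h3 := hgd y hy
    have h4 := dist_triangle_right x y (g x)
    rw [← hxy] at h3
    linarith
  calc (Y.card : ℝ) ≤ F.card := by exact_mod_cast hYF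
    _ ≤ ((2 : ℝ) ^ D) ^ (t + 1) := hcard
    _ = ((2 : ℝ) ^ (t + 1)) ^ D := by
        rw [← Real.rpow_natCast, ← Real.rpow_natCast, ← Real.rpow_mul (by norm_num),
          ← Real.rpow_mul (by norm_num), mul_comm]
    _ ≤ (8 / δ) ^ D := by
        refine Real.rpow_le_rpow (by positivity) ?_ hD0
        rw [pow_succ]
        calc (2 : ℝ) ^ t * 2 ≤ 4 / δ * 2 := by gcongr
          _ = 8 / δ := by ring

end Doubling

/-! ### CoverWithBalls -/

section Cover

variable {M : Type*} [MetricSpace M]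

/-- The properties of the output of `CoverWithBalls`, in terms of the proxy function. -/
lemma coverLoop_spec (sel : Selector M) (w : M →₀ ℕ) (X : Finset M) {δ R : ℝ} (hδ : 0 ≤ δ)
    (hR : 0 ≤ R) (Q : Finset M) :
    ∃ π : M → M, (∀ p ∈ Q, π p ∈ Q ∧ dist p (π p) ≤ δ * max R (distTo p X)) ∧
      coverLoop sel w X δ R Q = ∑ p ∈ Q, Finsupp.single (π p) (w p) ∧
      ∀ x ∈ Q, ∀ y ∈ Q, π x ≠ π y →
        δ * min (max R (distTo (π x) X)) (max R (distTo (π y) X)) < dist (π x) (π y) := by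
  induction hn : Q.card using Nat.strong_induction_on generalizing Q with
  | _ n ih =>
  rw [coverLoop]
  split_ifs with h
  · set q : M := (sel Q h : M) with hq
    have hqQ : q ∈ Q := (sel Q h).2
    set B := coveredBy X δ R Q q with hB
    have hBQ : B ⊆ Q := Finset.filter_subset _ _
    have hqB : q ∈ B := Finset.mem_filter.2 ⟨hqQ, Or.inl rfl⟩
    have hlt : (Q \ B).card < n := by
      rw [← hn]
      exact Finset.card_lt_card (Finset.sdiff_ssubset hBQ ⟨q, hqB⟩)
    obtain ⟨π, h1, h2, h3⟩ := ih _ hlt (Q \ B) rfl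
    -- A proxy chosen later survived the removal around `q`, so its own threshold is exceeded. Which
    -- of two points is selected first is unknown, whence the `min` in the symmetric statement.
    have hout : ∀ x ∈ Q, x ∉ B → ∀ y, π x = y →
        δ * min (max R (distTo y X)) (max R (distTo q X)) < dist y q := by
      rintro x hx hxB y rfl
      have h4 := Finset.mem_sdiff.1 (h1 x (Finset.mem_sdiff.2 ⟨hx, hxB⟩)).1
      have h5 : ¬ (π x = q ∨ dist (π x) q ≤ δ * max R (distTo (π x) X)) := fun h6 =>
        h4.2 (Finset.mem_filter.2 ⟨h4.1, h6⟩)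
      push Not at h5
      refine lt_of_le_of_lt ?_ h5.2
      gcongr
      exact min_le_left _ _
    refine ⟨fun p => if p ∈ B then q else π p, fun p hp => ?_, ?_, fun x hx y hy hxy => ?_⟩
    · by_cases hpB : p ∈ B
      · simp only [hpB, if_true, hqQ, true_and]
        rcases (Finset.mem_filter.1 hpB).2 with h4 | h4
        · rw [h4, dist_self]
          exact mul_nonneg hδ (hR.trans (le_max_left _ _))
        · exact h4
      · simp only [hpB, if_false]
        have := h1 p (Finset.mem_sdiff.2 ⟨hp, hpB⟩)
        exact ⟨(Finset.mem_sdiff.1 this.1).1, this.2⟩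
    · rw [h2, ← Finset.sum_sdiff hBQ, add_comm]
      congr 1
      · refine Finset.sum_congr rfl fun p hp => ?_
        simp only [if_neg (Finset.mem_sdiff.1 hp).2]
      · rw [Finsupp.single_finsetSum]
        exact Finset.sum_congr rfl fun p hp => by simp only [if_pos hp]
    · by_cases hxB : x ∈ B <;> by_cases hyB : y ∈ B
      · simp [hxB, hyB] at hxy
      · simp only [hxB, hyB, if_true, if_false]
        rw [min_comm, dist_comm]
        exact hout y hy hyB _ rfl
      · simp only [hxB, hyB, if_true, if_false]
        exact hout x hx hxB _ rfl
      · simp only [hxB, hyB, if_false] at hxy ⊢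
        exact h3 x (by simp [hx, hxB]) y (by simp [hy, hyB]) hxy
  · rw [Finset.not_nonempty_iff_eq_empty] at h
    subst h
    exact ⟨id, by simp, by simp, by simp⟩

/-- The points of a cover are far apart. -/
def IsSeparated (Y X : Finset M) (δ R : ℝ) : Prop :=
  ∀ x ∈ Y, ∀ y ∈ Y, x ≠ y → δ * min (max R (distTo x X)) (max R (distTo y X)) < dist x y

lemma coverWithBalls_spec (sel : Selector M) (w : M →₀ ℕ) (X : Finset M) {δ R : ℝ}
    (hδ : 0 ≤ δ) (hR : 0 ≤ R) :
    ∃ π : M → M, (∀ p ∈ w.support, π p ∈ (coverWithBalls sel w X δ R).support ∧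
        dist p (π p) ≤ δ * max R (distTo p X)) ∧
      coverWithBalls sel w X δ R = ∑ p ∈ w.support, Finsupp.single (π p) (w p) ∧
      (coverWithBalls sel w X δ R).support ⊆ w.support ∧
      IsSeparated (coverWithBalls sel w X δ R).support X δ R := by
  obtain ⟨π, h1, h2, h3⟩ := coverLoop_spec sel w X hδ hR w.support
  have hsub : (coverWithBalls sel w X δ R).support ⊆ w.support.image π := by
    rw [coverWithBalls, h2]
    refine Finsupp.support_finsetSum.trans ?_
    refine Finset.biUnion_subset.2 fun p hp => ?_
    refine Finsupp.support_single_subset.trans ?_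
    simpa using ⟨p, by simpa using hp, rfl⟩
  refine ⟨π, fun p hp => ⟨?_, (h1 p hp).2⟩, h2, fun x hx => ?_, fun x hx y hy hxy => ?_⟩
  -- Weights are natural numbers and cannot cancel, so a proxy of a point of positive weight has
  -- positive weight.
  · rw [coverWithBalls, h2, Finsupp.mem_support_iff, Finsupp.finsetSum_apply]
    intro h0
    rw [Finset.sum_eq_zero_iff] at h0
    have := h0 p hp
    simp at this
    simp [this] at hp
  · obtain ⟨p, hp, rfl⟩ := Finset.mem_image.1 (hsub hx)
    exact (h1 p hp).1
  · obtain ⟨p, hp, rfl⟩ := Finset.mem_image.1 (hsub hx)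
    obtain ⟨q, hq, rfl⟩ := Finset.mem_image.1 (hsub hy)
    exact h3 p hp q hq hxy

lemma support_unitWeights (Q : Finset M) : (unitWeights Q).support = Q := by
  rw [unitWeights_eq_push, support_push, Finset.image_id]

lemma coverWithBalls_unitWeights_spec (sel : Selector M) (Q X : Finset M) {δ R : ℝ}
    (hδ : 0 ≤ δ) (hR : 0 ≤ R) :
    ∃ π : M → M, (∀ p ∈ Q, dist p (π p) ≤ δ * max R (distTo p X)) ∧
      coverWithBalls sel (unitWeights Q) X δ R = push Q π ∧
      (coverWithBalls sel (unitWeights Q) X δ R).support ⊆ Q := by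
  obtain ⟨π, h1, h2, h3, -⟩ := coverWithBalls_spec sel (unitWeights Q) X hδ hR
  rw [support_unitWeights] at *
  refine ⟨π, fun p hp => (h1 p hp).2, ?_, h3⟩
  rw [h2, push]
  refine Finset.sum_congr rfl fun p hp => ?_
  congr
  rw [unitWeights_eq_push, push_apply]
  rw [Finset.card_eq_one]
  exact ⟨p, by ext x; simp; rintro rfl; exact hp⟩

/-- Rings: a number in `[R, 2 ^ J R]` lies in `[r, 2 r]` for some `r = 2 ^ j R`, `j < J`. -/
lemma exists_ring {R m : ℝ} (h1 : R ≤ m) {J : ℕ} (hJ : 0 < J) (h2 : m ≤ 2 ^ J * R) :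
    ∃ j < J, 2 ^ j * R ≤ m ∧ m ≤ 2 * (2 ^ j * R) := by
  induction J with
  | zero => omega
  | succ J ih =>
    by_cases hm : 2 ^ J * R ≤ m
    · exact ⟨J, by omega, hm, by rw [pow_succ] at h2; linarith⟩
    · rcases J.eq_zero_or_pos with rfl | hJ0
      · simp at hm; linarith
      · obtain ⟨j, hj, h⟩ := ih hJ0 (not_le.1 hm).le
        exact ⟨j, by omega, h⟩

/-- A separated set whose points are not too far from `X`, and have their nearest points in
`X'`, is small. -/
lemma IsSeparated.card_le {P : Finset M} {D : ℝ} (hD : IsDoubling P D) {Y X X' : Finset M}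
    {δ R : ℝ} (hδ : 0 < δ) (hδ1 : δ ≤ 1) (hR : 0 ≤ R) (hYP : Y ⊆ P) (hX' : X' ⊆ P)
    (hY : IsSeparated Y X δ R) {J : ℕ} (hJ : 0 < J)
    (hnear : ∀ y ∈ Y, distTo y X ≤ 2 ^ J * R ∧ ∃ x ∈ X', distTo y X = dist y x) :
    (Y.card : ℝ) ≤ X'.card * (J * (8 / δ) ^ D) := by
  choose! g hg hgd using fun y hy => (hnear y hy).2
  have h2J : R ≤ 2 ^ J * R := by
    have : (1 : ℝ) ≤ 2 ^ J := one_le_pow₀ one_le_two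
    nlinarith
  choose! j hjJ hj1 hj2 using fun y hy =>
    exists_ring (le_max_left R (distTo y X)) hJ (max_le h2J (hnear y hy).1)
  -- The points are classified by nearest center and dyadic ring; each class lies in a ball of
  -- radius 2r and is δr-separated.
  have hmaps : ∀ y ∈ Y, (g y, j y) ∈ X' ×ˢ Finset.range J := fun y hy =>
    Finset.mem_product.2 ⟨hg y hy, Finset.mem_range.2 (hjJ y hy)⟩
  rw [Finset.card_eq_sum_card_fiberwise (f := fun y => (g y, j y)) hmaps]
  push_cast
  calc _ ≤ ∑ b ∈ X' ×ˢ Finset.range J, (8 / δ) ^ D := by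
        refine Finset.sum_le_sum fun b hb => ?_
        have hb1 := (Finset.mem_product.1 hb).1
        refine card_le_of_separated hD (hX' hb1) hδ hδ1 (r := 2 ^ b.2 * R) (by positivity)
          ((Finset.filter_subset _ _).trans hYP) (fun y hy => ?_) (fun x hx y hy hxy => ?_)
        · obtain ⟨hyY, rfl⟩ := Finset.mem_filter.1 hy
          rw [← hgd y hyY]
          exact (le_max_right _ _).trans (hj2 y hyY)
        · obtain ⟨hxY, rfl⟩ := Finset.mem_filter.1 hx
          obtain ⟨hyY, hyb⟩ := Finset.mem_filter.1 hy
          simp only [Prod.mk.injEq] at hyb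
          refine lt_of_le_of_lt ?_ (hY x hxY y hyY hxy)
          gcongr
          refine le_min (hj1 x hxY) ?_
          rw [← hyb.2]
          exact hj1 y hyY
    _ = _ := by
        rw [Finset.sum_const, Finset.card_product, Finset.card_range, nsmul_eq_mul]
        push_cast; ring

/-- A separated set of points farther than `r` from `X` and within `2 r` of `X'` is small. -/
lemma IsSeparated.card_le_of_far {P : Finset M} {D : ℝ} (hD : IsDoubling P D)
    {Y X X' : Finset M} {δ R r : ℝ} (hδ : 0 < δ) (hδ1 : δ ≤ 1) (hr : 0 ≤ r) (hYP : Y ⊆ P)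
    (hX' : X' ⊆ P) (hY : IsSeparated Y X δ R)
    (hfar : ∀ y ∈ Y, r ≤ distTo y X) (hnear : ∀ y ∈ Y, ∃ x ∈ X', dist y x ≤ 2 * r) :
    (Y.card : ℝ) ≤ X'.card * (8 / δ) ^ D := by
  choose! g hg hgd using hnear
  rw [Finset.card_eq_sum_card_fiberwise (f := g) hg]
  push_cast
  calc _ ≤ ∑ b ∈ X', (8 / δ) ^ D := by
        refine Finset.sum_le_sum fun b hb => ?_
        refine card_le_of_separated hD (hX' hb) hδ hδ1 hr
          ((Finset.filter_subset _ _).trans hYP) (fun y hy => ?_) (fun x hx y hy hxy => ?_)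
        · obtain ⟨hyY, rfl⟩ := Finset.mem_filter.1 hy
          exact hgd y hyY
        · have hx := (Finset.mem_filter.1 hx).1
          have hy := (Finset.mem_filter.1 hy).1
          refine lt_of_le_of_lt ?_ (hY x hx y hy hxy)
          gcongr
          exact le_min ((hfar x hx).trans (le_max_right _ _)) ((hfar y hy).trans (le_max_right _ _))
    _ = _ := by rw [Finset.sum_const, nsmul_eq_mul]

lemma IsSeparated.mono {Y Y' X : Finset M} {δ R : ℝ} (h : IsSeparated Y X δ R) (hY : Y' ⊆ Y) :
    IsSeparated Y' X δ R := fun x hx y hy => h x (hY hx) y (hY hy)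

/-- The size of a cover of points at distance at most `2 ^ J R` from `S`, with respect to a
cover `C'` of a set with centers `SC` (at arbitrary distances from `SC`). -/
lemma card_le_of_separated_twice {P : Finset M} {D : ℝ} (hD : IsDoubling P D)
    {T C' SC S : Finset M} {δ R : ℝ} {k J : ℕ} (hδ : 0 < δ) (hδ1 : δ ≤ 1) (hR : 0 ≤ R)
    (hTP : T ⊆ P) (hCP : C' ⊆ P) (hSCP : SC ⊆ P) (hSP : S ⊆ P) (hC0 : C'.Nonempty)
    (hSC0 : SC.Nonempty) (hSC : SC.card ≤ k) (hS : S.card ≤ k) (hJ : 0 < J)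
    (hT : IsSeparated T C' δ R) (hC' : IsSeparated C' SC δ R)
    (hTS : ∀ p ∈ T, ∃ s ∈ S, dist p s ≤ 2 ^ J * R) :
    (T.card : ℝ) ≤ 3 * k * J ^ 2 * ((8 / δ) ^ D) ^ 2 := by
  obtain ⟨c₀, hc₀⟩ := id hC0
  have hD0 := hD.nonneg ⟨c₀, hCP hc₀⟩
  set Λ := 2 ^ J * R with hΛdef
  set E := (8 / δ) ^ D with hE
  have hE1 : 1 ≤ E := Real.one_le_rpow (by rw [le_div_iff₀ hδ]; linarith) hD0
  have hΛ : 0 ≤ Λ := by positivity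
  have hJ1 : (1 : ℝ) ≤ J := by exact_mod_cast hJ
  have hSC' : (SC.card : ℝ) ≤ k := by exact_mod_cast hSC
  have hS' : (S.card : ℝ) ≤ k := by exact_mod_cast hS
  choose g hg hgd using fun p : M => exists_distTo_eq p hC0
  -- Distances to `C'` and `SC` have no bound in terms of `R`. Points farther than Λ from `C'` are
  -- counted around `S` instead: they are δΛ-separated and within Λ of `S`.
  set T₁ := T.filter fun p => Λ < distTo p C'
  set T₂ := T.filter fun p => ¬ Λ < distTo p C'
  have hT12 : T.card = T₁.card + T₂.card := (Finset.card_filter_add_card_filter_not _).symm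
  have hb1 : (T₁.card : ℝ) ≤ k * E := by
    refine ((hT.mono (Finset.filter_subset _ _)).card_le_of_far hD hδ hδ1 hΛ
      ((Finset.filter_subset _ _).trans hTP) hSP (fun y hy => (Finset.mem_filter.1 hy).2.le)
      fun y hy => ?_).trans (by gcongr)
    obtain ⟨s, hs, h⟩ := hTS y (Finset.mem_filter.1 hy).1
    exact ⟨s, hs, by linarith⟩
  -- Only the points of `C'` nearest to some point of `T₂` matter. They are within Λ of `T₂`, hence
  -- within 2Λ of `S`, so the same dichotomy applies to them with respect to `SC`.
  set X := T₂.image g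
  have hXC : X ⊆ C' := by
    intro x hx
    obtain ⟨p, -, rfl⟩ := Finset.mem_image.1 hx
    exact hg p
  have hb2 : (T₂.card : ℝ) ≤ X.card * (J * E) := by
    refine (hT.mono (Finset.filter_subset _ _)).card_le hD hδ hδ1 hR
      ((Finset.filter_subset _ _).trans hTP) (hXC.trans hCP) hJ fun y hy => ?_
    exact ⟨not_lt.1 (Finset.mem_filter.1 hy).2, g y, Finset.mem_image_of_mem _ hy, hgd y⟩
  set X₁ := X.filter fun c => Λ < distTo c SC
  set X₂ := X.filter fun c => ¬ Λ < distTo c SC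
  have hX12 : X.card = X₁.card + X₂.card := (Finset.card_filter_add_card_filter_not _).symm
  have hb3 : (X₁.card : ℝ) ≤ k * E := by
    refine ((hC'.mono ((Finset.filter_subset _ _).trans hXC)).card_le_of_far hD hδ hδ1 hΛ
      ((Finset.filter_subset _ _).trans (hXC.trans hCP)) hSP
      (fun y hy => (Finset.mem_filter.1 hy).2.le) fun y hy => ?_).trans (by gcongr)
    obtain ⟨p, hp, rfl⟩ := Finset.mem_image.1 (Finset.mem_filter.1 hy).1
    obtain ⟨hpT, hp⟩ := Finset.mem_filter.1 hp
    obtain ⟨s, hs, h⟩ := hTS p hpT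
    refine ⟨s, hs, ?_⟩
    have h1 := dist_triangle_left (g p) s p
    rw [← hgd p] at h1
    linarith
  have hb4 : (X₂.card : ℝ) ≤ k * (J * E) := by
    refine ((hC'.mono ((Finset.filter_subset _ _).trans hXC)).card_le hD hδ hδ1 hR
      ((Finset.filter_subset _ _).trans (hXC.trans hCP)) hSCP hJ fun y hy => ?_).trans (by gcongr)
    exact ⟨not_lt.1 (Finset.mem_filter.1 hy).2, exists_distTo_eq y hSC0⟩
  rw [hT12]
  push_cast
  have hX : (X.card : ℝ) ≤ k * E + k * (J * E) := by rw [hX12]; push_cast; linarith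
  have hk : (0 : ℝ) ≤ k := by positivity
  calc (T₁.card : ℝ) + T₂.card ≤ k * E + (k * E + k * (J * E)) * (J * E) := by
        refine add_le_add hb1 (hb2.trans ?_)
        gcongr
    _ = k * (1 * 1 * E * 1 + 1 * J * E ^ 2 + J ^ 2 * E ^ 2) := by ring
    _ ≤ k * (J * J * E * E + J * J * E ^ 2 + J ^ 2 * E ^ 2) := by gcongr
    _ = _ := by ring

end Cover

/-! ### Cost of replacing points by proxies -/

section Accuracy

variable {M : Type*} [MetricSpace M]

/-- Young's inequality (a + e)² ≤ (1 + γ)a² + (1 + 1/γ)e²: an error of order γ² becomes an additive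
term of order γ. -/
lemma sum_add_sq_le {ι : Type*} (s : Finset ι) (a e : ι → ℝ) {γ K O : ℝ} (hγ : 0 < γ)
    (hγ1 : γ ≤ 1) (hK : 0 ≤ K * O) (he : ∑ i ∈ s, e i ^ 2 ≤ K * γ ^ 2 * O) :
    ∑ i ∈ s, (a i + e i) ^ 2 ≤ (1 + γ) * ∑ i ∈ s, a i ^ 2 + 2 * K * γ * O := by
  have key : ∀ i ∈ s, (a i + e i) ^ 2 ≤ (1 + γ) * a i ^ 2 + (1 + 1 / γ) * e i ^ 2 := by
    intro i _
    have h : 0 ≤ (γ * a i - e i) ^ 2 / γ := by positivity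
    have h' : (γ * a i - e i) ^ 2 / γ = γ * a i ^ 2 - 2 * a i * e i + 1 / γ * e i ^ 2 := by
      field_simp; ring
    nlinarith
  have hg : (1 + 1 / γ) * (K * γ ^ 2 * O) = (γ + 1) * γ * (K * O) := by field_simp
  have h2 : (γ + 1) * γ * (K * O) ≤ 2 * γ * (K * O) := by gcongr; linarith
  calc ∑ i ∈ s, (a i + e i) ^ 2
      ≤ ∑ i ∈ s, ((1 + γ) * a i ^ 2 + (1 + 1 / γ) * e i ^ 2) := Finset.sum_le_sum key
    _ = (1 + γ) * ∑ i ∈ s, a i ^ 2 + (1 + 1 / γ) * ∑ i ∈ s, e i ^ 2 := by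
        rw [Finset.sum_add_distrib, Finset.mul_sum, Finset.mul_sum]
    _ ≤ (1 + γ) * ∑ i ∈ s, a i ^ 2 + (1 + 1 / γ) * (K * γ ^ 2 * O) := by gcongr
    _ ≤ _ := by rw [hg]; linarith

lemma max_sq_le {x y : ℝ} : max x y ^ 2 ≤ x ^ 2 + y ^ 2 := by
  rcases max_cases x y with ⟨h, -⟩ | ⟨h, -⟩ <;> rw [h] <;> nlinarith [sq_nonneg x, sq_nonneg y]

lemma sum_sq_le_of_le_max {ι : Type*} (Q : Finset ι) {f g : ι → ℝ} {δ R : ℝ}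
    (hf : ∀ p ∈ Q, 0 ≤ f p) (h : ∀ p ∈ Q, f p ≤ δ * max R (g p)) :
    ∑ p ∈ Q, f p ^ 2 ≤ δ ^ 2 * (Q.card * R ^ 2 + ∑ p ∈ Q, g p ^ 2) := by
  calc ∑ p ∈ Q, f p ^ 2 ≤ ∑ p ∈ Q, δ ^ 2 * (R ^ 2 + g p ^ 2) := by
        refine Finset.sum_le_sum fun p hp => (pow_le_pow_left₀ (hf p hp) (h p hp) 2).trans ?_
        rw [mul_pow]
        gcongr
        exact max_sq_le
    _ = _ := by rw [← Finset.mul_sum, Finset.sum_add_distrib, Finset.sum_const, nsmul_eq_mul]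

lemma sum_add_sq_le_two {ι : Type*} (s : Finset ι) (f a b : ι → ℝ) (hf : ∀ i ∈ s, 0 ≤ f i)
    (h : ∀ i ∈ s, f i ≤ a i + b i) :
    ∑ i ∈ s, f i ^ 2 ≤ 2 * ∑ i ∈ s, a i ^ 2 + 2 * ∑ i ∈ s, b i ^ 2 := by
  rw [Finset.mul_sum, Finset.mul_sum, ← Finset.sum_add_distrib]
  refine Finset.sum_le_sum fun i hi => ?_
  have h1 := hf i hi
  have h2 := h i hi
  nlinarith [sq_nonneg (a i - b i)]

/-- A bound for the cost of the second-level cover. -/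
lemma cost_cover_le {P X C' SC : Finset M} {π : M → M} {k : ℕ} {β γ δ R O : ℝ}
    (hP : P.Nonempty) (hβ : 1 ≤ β) (hγ : 0 < γ) (hγ1 : γ ≤ 1 / 10) (hδ : 2 * β * δ ^ 2 = γ ^ 2)
    (hX : X.Nonempty) (hXk : X.card ≤ k) (hXO : cost P X ≤ O) (hR : P.card * R ^ 2 ≤ 4 * β * O)
    (hπ : ∑ p ∈ P, dist p (π p) ^ 2 ≤ 4 * γ ^ 2 * O)
    (hSC : wcost (push P π) SC ≤ β * optWKMeans k (push P π))
    (hC' : ∀ p ∈ P, distTo (π p) C' ≤ δ * max R (distTo (π p) SC)) :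
    cost P C' ≤ O := by
  have hO : 0 ≤ O := (cost_nonneg P X).trans hXO
  have h1 : wcost (push P π) X ≤ 2 * (4 * γ ^ 2 * O) + 2 * O := by
    rw [wcost_push]
    refine (sum_add_sq_le_two P _ (fun p => dist p (π p)) (fun p => distTo p X)
      (fun p _ => distTo_nonneg _ _) fun p _ => ?_).trans (by unfold cost at hXO; linarith)
    rw [dist_comm]
    exact distTo_le_add _ _ _
  have h2 : optWKMeans k (push P π) ≤ 4 * wcost (push P π) X :=
    optWKMeans_le_four_mul (by rw [support_push]; exact hP.image π) hX hXk
  have h3 : wcost (push P π) SC ≤ β * (4 * (2 * (4 * γ ^ 2 * O) + 2 * O)) :=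
    hSC.trans (by gcongr; linarith)
  have h4 := sum_sq_le_of_le_max P (fun p _ => distTo_nonneg (π p) C') hC'
  rw [← wcost_push P π SC] at h4
  have h5 : cost P C' ≤ 2 * ∑ p ∈ P, dist p (π p) ^ 2 + 2 * ∑ p ∈ P, distTo (π p) C' ^ 2 :=
    sum_add_sq_le_two P _ _ _ (fun p _ => distTo_nonneg _ _) fun p _ => distTo_le_add _ _ _
  have h6 : ∑ p ∈ P, distTo (π p) C' ^ 2 ≤
      δ ^ 2 * (4 * β * O + β * (4 * (2 * (4 * γ ^ 2 * O) + 2 * O))) :=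
    h4.trans (by gcongr)
  -- The factor β in both terms is absorbed by δ²; what remains is of order γ², which γ ≤ 1/10
  -- brings below `O`.
  have h7 : δ ^ 2 * (4 * β * O + β * (4 * (2 * (4 * γ ^ 2 * O) + 2 * O))) =
      γ ^ 2 * (2 * O + 16 * γ ^ 2 * O + 4 * O) := by rw [← hδ]; ring
  have hγ2 : γ ^ 2 ≤ 1 / 100 := by nlinarith
  have h8 : γ ^ 2 * O ≤ 1 / 100 * O := by gcongr
  have h9 : γ ^ 2 * (16 * γ ^ 2 * O) ≤ 1 / 100 * (16 * (1 / 100 * O)) := by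
    rw [mul_assoc 16]
    gcongr
  nlinarith

/-- The solution of the weighted problem on the proxies is a solution of the original
problem. -/
lemma cost_sdiff_le_of_proxies {P S₀ Z₀ C' S Z : Finset M} {π : M → M} {k z z' : ℕ}
    {α β γ δ R O : ℝ}
    (hα : 0 < α) (hβ : 1 ≤ β) (hγ : 0 < γ) (hγ1 : γ ≤ 1 / 10) (hδ0 : 0 ≤ δ) (hR0 : 0 ≤ R)
    (hδ : 2 * β * δ ^ 2 = γ ^ 2) (hS₀ : IsCenters P k S₀) (hZ₀ : Z₀ ⊆ P)
    (hZ₀c : Z₀.card = min z P.card) (hO : cost (P \ Z₀) S₀ = O)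
    (hR : P.card * R ^ 2 ≤ 4 * β * O) (hC' : cost P C' ≤ O)
    (hπ : ∀ p ∈ P, dist p (π p) ≤ δ * max R (distTo p C'))
    (hS : ∀ w', IsScaled (push P π) S z' w' → wcost w' S ≤ α * optWOut k z (push P π))
    (hZ : IsOut P S z' Z) :
    cost (P \ Z) S ≤ (α + 99 * (1 + α) * γ) * O := by
  have hO0 : 0 ≤ O := hO ▸ cost_nonneg _ _
  have hδβ : δ ^ 2 * (4 * β * O) = 2 * γ ^ 2 * O := by rw [← hδ]; ring
  have hδ2 : δ ^ 2 ≤ γ ^ 2 / 2 := by nlinarith [sq_nonneg δ]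
  have hΔ : ∑ p ∈ P, dist p (π p) ^ 2 ≤ 3 * γ ^ 2 * O := by
    have h1 := sum_sq_le_of_le_max P (fun p _ => dist_nonneg) hπ
    have h2 : δ ^ 2 * (P.card * R ^ 2 + ∑ p ∈ P, distTo p C' ^ 2) ≤ δ ^ 2 * (4 * β * O + O) := by
      gcongr; exact hC'
    have h3 : δ ^ 2 * O ≤ γ ^ 2 / 2 * O := by gcongr
    nlinarith [mul_nonneg (sq_nonneg γ) hO0]
  obtain ⟨hS₀P, hS₀n, hS₀k⟩ := hS₀
  -- the optimum on the proxies
  have hopt : optWOut k z (push P π) ≤ (1 + 49 * γ) * O := by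
    obtain ⟨Y, hYP, hYc, hY⟩ := exists_farthest P (fun p => distTo (π p) (S₀.image π))
      (min_le_right z P.card)
    have hcen : IsCenters (push P π).support k (S₀.image π) := by
      refine ⟨?_, hS₀n.image π, Finset.card_image_le.trans hS₀k⟩
      rw [support_push]
      exact Finset.image_subset_image hS₀P
    refine (optWOut_le hcen (isScaled_push hYP hYc hY)).trans ?_
    rw [wcost_push]
    -- Discarding the optimal outliers `Z₀` rather than the points with farthest images can only
    -- increase the sum.
    refine (sum_sdiff_farthest_le (fun p => distTo_nonneg _ _) hYP hZ₀ (by omega) hY).trans ?_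
    choose c hc hcd using fun p : M => exists_distTo_eq p hS₀n
    -- Displacement of the center `c p` serving `p`. One center may serve many points, so its
    -- displacement is bounded through d(c p, C') ≤ d(p, S₀) + d(p, C') and only then summed over
    -- `p`.
    have hmove : ∑ p ∈ P \ Z₀, dist (c p) (π (c p)) ^ 2 ≤ 9 * γ ^ 2 * O := by
      have h1 : ∀ p ∈ P \ Z₀, dist (c p) (π (c p)) ^ 2 ≤
          3 * δ ^ 2 * (R ^ 2 + distTo p S₀ ^ 2 + distTo p C' ^ 2) := by
        intro p _
        have h2 := hπ (c p) (hS₀P (hc p))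
        have h3 := distTo_le_add (c p) p C'
        rw [dist_comm, ← hcd p] at h3
        have ha := distTo_nonneg p S₀
        have hb := distTo_nonneg p C'
        have h4 : max R (distTo (c p) C') ≤ R + distTo p S₀ + distTo p C' :=
          max_le (by linarith) (by linarith)
        have h5 : dist (c p) (π (c p)) ≤ δ * (R + distTo p S₀ + distTo p C') :=
          h2.trans (by gcongr)
        calc dist (c p) (π (c p)) ^ 2 ≤ (δ * (R + distTo p S₀ + distTo p C')) ^ 2 :=
              pow_le_pow_left₀ dist_nonneg h5 2
          _ = δ ^ 2 * (R + distTo p S₀ + distTo p C') ^ 2 := mul_pow _ _ _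
          _ ≤ δ ^ 2 * (3 * (R ^ 2 + distTo p S₀ ^ 2 + distTo p C' ^ 2)) := by
              gcongr
              nlinarith [sq_nonneg (R - distTo p S₀), sq_nonneg (R - distTo p C'),
                sq_nonneg (distTo p S₀ - distTo p C')]
          _ = _ := by ring
      refine (Finset.sum_le_sum h1).trans ?_
      rw [← Finset.mul_sum, Finset.sum_add_distrib, Finset.sum_add_distrib, Finset.sum_const,
        nsmul_eq_mul]
      have h2 : ((P \ Z₀).card : ℝ) * R ^ 2 ≤ 4 * β * O := by
        refine le_trans ?_ hR
        gcongr
        exact Finset.sdiff_subset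
      have h3 : ∑ p ∈ P \ Z₀, distTo p C' ^ 2 ≤ O :=
        (Finset.sum_le_sum_of_subset_of_nonneg Finset.sdiff_subset
          fun _ _ _ => sq_nonneg _).trans hC'
      have h4 : ∑ p ∈ P \ Z₀, distTo p S₀ ^ 2 = O := hO
      rw [h4]
      calc _ ≤ 3 * δ ^ 2 * (4 * β * O + O + O) := by gcongr
        _ = 3 * (δ ^ 2 * (4 * β * O)) + 6 * (δ ^ 2 * O) := by ring
        _ ≤ 3 * (2 * γ ^ 2 * O) + 6 * (γ ^ 2 / 2 * O) := by rw [hδβ]; gcongr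
        _ = _ := by ring
    have he : ∑ p ∈ P \ Z₀, (dist p (π p) + dist (c p) (π (c p))) ^ 2 ≤ 24 * γ ^ 2 * O := by
      refine (sum_add_sq_le_two _ _ (fun p => dist p (π p)) (fun p => dist (c p) (π (c p)))
        (fun p _ => by positivity) fun p _ => le_rfl).trans ?_
      have : ∑ p ∈ P \ Z₀, dist p (π p) ^ 2 ≤ 3 * γ ^ 2 * O :=
        (Finset.sum_le_sum_of_subset_of_nonneg Finset.sdiff_subset
          fun _ _ _ => sq_nonneg _).trans hΔ
      linarith
    calc _ ≤ ∑ p ∈ P \ Z₀, (distTo p S₀ + (dist p (π p) + dist (c p) (π (c p)))) ^ 2 := by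
          refine Finset.sum_le_sum fun p _ => pow_le_pow_left₀ (distTo_nonneg _ _) ?_ 2
          refine (distTo_le_dist (π p) (Finset.mem_image_of_mem π (hc p))).trans ?_
          have h1 := dist_triangle4 (π p) p (c p) (π (c p))
          rw [hcd p]
          rw [dist_comm (π p) p] at h1
          linarith
      _ ≤ (1 + γ) * ∑ p ∈ P \ Z₀, distTo p S₀ ^ 2 + 2 * 24 * γ * O :=
          sum_add_sq_le _ _ _ hγ (by linarith) (by positivity) he
      _ = (1 + γ) * O + 2 * 24 * γ * O := by rw [← hO]; rfl
      _ = _ := by ring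
  -- The subroutine discards by distance of proxies, the conclusion by distance of the points
  -- themselves. The latter choice is the cheapest for P, so it suffices to bound the cost with `Y`
  -- removed.
  obtain ⟨Y, hYP, hYc, hY⟩ := exists_farthest P (fun p => distTo (π p) S)
    (min_le_right z' P.card)
  have hw := hS _ (isScaled_push hYP hYc hY)
  rw [wcost_push] at hw
  obtain ⟨hZP, hZc, hZf⟩ := hZ
  calc cost (P \ Z) S ≤ cost (P \ Y) S :=
        sum_sdiff_farthest_le (fun p => distTo_nonneg _ _) hZP hYP (by omega) hZf
    _ ≤ ∑ p ∈ P \ Y, (distTo (π p) S + dist p (π p)) ^ 2 := by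
        refine Finset.sum_le_sum fun p _ => pow_le_pow_left₀ (distTo_nonneg _ _) ?_ 2
        linarith [distTo_le_add p (π p) S]
    _ ≤ (1 + γ) * ∑ p ∈ P \ Y, distTo (π p) S ^ 2 + 2 * 3 * γ * O :=
        sum_add_sq_le _ _ _ hγ (by linarith) (by positivity)
          ((Finset.sum_le_sum_of_subset_of_nonneg Finset.sdiff_subset
            fun _ _ _ => sq_nonneg _).trans hΔ)
    _ ≤ (1 + γ) * (α * ((1 + 49 * γ) * O)) + 2 * 3 * γ * O := by
        gcongr
        exact hw.trans (by gcongr)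
    -- Expanding gives α + 50αγ + 49αγ² + 6γ; with γ ≤ 1 this accounts for the constant 99.
    _ ≤ _ := by
        have h1 : 0 ≤ α * γ * O := by positivity
        have h2 : 0 ≤ γ * O := by positivity
        have h3 : γ * (α * γ * O) ≤ 1 * (α * γ * O) := by gcongr; linarith
        nlinarith

/-- There are finitely many pairs of centers and outliers, so the infimum is attained. -/
lemma exists_optOut_eq {P : Finset M} (k z : ℕ) (hP : P.Nonempty) (hk : 0 < k) :
    ∃ S Z, IsCenters P k S ∧ IsOut P S z Z ∧ cost (P \ Z) S = optOut k z P := by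
  set A : Set ℝ := {c | ∃ S Z, IsCenters P k S ∧ IsOut P S z Z ∧ c = cost (P \ Z) S}
  have hfin : A.Finite := by
    refine ((P.powerset ×ˢ P.powerset).image fun x => cost (P \ x.2) x.1).finite_toSet.subset ?_
    rintro _ ⟨S, Z, hS, hZ, rfl⟩
    simp only [Finset.coe_image, Set.mem_image]
    exact ⟨(S, Z), by simpa using ⟨hS.1, hZ.1⟩, rfl⟩
  have hne : A.Nonempty := by
    obtain ⟨p, hp⟩ := hP
    obtain ⟨Z, hZ, hZc, hZf⟩ := exists_farthest P (fun q => distTo q {p}) (min_le_right z P.card)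
    exact ⟨_, {p}, Z, ⟨by simpa using hp, by simp, by simpa using Nat.succ_le_of_lt hk⟩, ⟨hZ, hZc, hZf⟩, rfl⟩
  obtain ⟨S, Z, hS, hZ, h⟩ := hne.csInf_mem hfin
  exact ⟨S, Z, hS, hZ, h.symm⟩

/-- Points of `Z` are at distance zero once `Z` is added to the centers. This is what reduces
outliers to k-means with more centers. -/
lemma cost_union_le (P S Z : Finset M) (hS : S.Nonempty) : cost P (S ∪ Z) ≤ cost (P \ Z) S := by
  unfold cost
  rw [← Finset.sum_sdiff (Finset.inter_subset_left (s₁ := P) (s₂ := Z)), Finset.sdiff_inter_self_left]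
  have h0 : ∑ p ∈ P ∩ Z, distTo p (S ∪ Z) ^ 2 = 0 := by
    refine Finset.sum_eq_zero fun p hp => ?_
    have h1 := distTo_le_dist p (S := S ∪ Z)
      (Finset.mem_union_right S (Finset.mem_inter.1 hp).2)
    rw [dist_self] at h1
    rw [le_antisymm h1 (distTo_nonneg _ _)]; norm_num
  rw [h0, add_zero]
  refine Finset.sum_le_sum fun p _ => pow_le_pow_left₀ (distTo_nonneg _ _) ?_ 2
  obtain ⟨s, hs, h⟩ := exists_distTo_eq p hS
  rw [h]
  exact distTo_le_dist p (Finset.mem_union_left Z hs)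

end Accuracy

/-! ### Additivity of MapReduce rounds -/

namespace Round

variable {V V' V'' : Type*} (r : Round V V' V'')

lemma mapped_add (X Y : Multiset (ℕ × V)) : r.mapped (X + Y) = r.mapped X + r.mapped Y :=
  Multiset.add_bind _ _ _

lemma mapped_sum {ι : Type*} (s : Finset ι) (f : ι → Multiset (ℕ × V)) :
    r.mapped (∑ i ∈ s, f i) = ∑ i ∈ s, r.mapped (f i) :=
  map_sum (⟨⟨r.mapped, rfl⟩, r.mapped_add⟩ : Multiset (ℕ × V) →+ Multiset (ℕ × V')) f s

lemma group_add (X Y : Multiset (ℕ × V)) (i : ℕ) :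
    r.group (X + Y) i = r.group X i + r.group Y i := by
  simp [group, mapped_add]

lemma group_sum {ι : Type*} (s : Finset ι) (f : ι → Multiset (ℕ × V)) (i : ℕ) :
    r.group (∑ j ∈ s, f j) i = ∑ j ∈ s, r.group (f j) i :=
  map_sum (⟨⟨fun X => r.group X i, rfl⟩, fun X Y => r.group_add X Y i⟩ :
    Multiset (ℕ × V) →+ Multiset V') f s

lemma mem_keys {X : Multiset (ℕ × V)} {i : ℕ} : i ∈ r.keys X ↔ ∃ v, (i, v) ∈ r.mapped X := by
  simp [keys]

lemma localMemory_le {X : Multiset (ℕ × V)} {B : ℕ} (h1 : ∀ x ∈ X, r.mapMemory x ≤ B)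
    (h2 : ∀ i ∈ r.keys X, r.reduceMemory i (r.group X i) ≤ B) : r.localMemory X ≤ B :=
  max_le (Finset.sup_le fun x hx => h1 x (Multiset.mem_toFinset.1 hx)) (Finset.sup_le h2)

end Round

lemma sum_map_singleton {ι α : Type*} (s : Finset ι) (f : ι → α) :
    ∑ i ∈ s, ({f i} : Multiset α) = s.val.map f := by
  rw [Finset.sum, ← Multiset.sum_map_singleton (s.val.map f), Multiset.map_map]
  rfl

lemma filterMap_none_eq_zero {α β : Type*} (s : Multiset α) :
    s.filterMap (fun _ => (none : Option β)) = 0 := by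
  induction s using Multiset.induction_on with
  | empty => rfl
  | cons x s ih => exact (Multiset.filterMap_cons_none x s rfl).trans ih

/-- The block `i` of the partition of `P`. -/
def blockSet {M : Type*} (a : Setup M) (P : Finset M) (i : ℕ) : Finset M :=
  P.filter fun p => a.block p = i

/-! ### Explicit form of the three rounds -/

section Execution

variable {M : Type*} [MetricSpace M] (a : Setup M) (P : Finset M)

/-- The centers computed by the first round on the block `i`. -/
def blockCenters (i : ℕ) : Finset M := a.seqKMeans.run (blockSet a P i, a.k')

/-- The radius computed by the first round on the block `i`. -/
def blockRadius (i : ℕ) : ℝ :=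
  √(cost (blockSet a P i) (blockCenters a P i) / (blockSet a P i).card)

/-- The cover computed by the first round on the block `i`. -/
def blockCover (i : ℕ) : M →₀ ℕ :=
  coverWithBalls (a.sel₁ i) (unitWeights (blockSet a P i)) (blockCenters a P i) a.δ
    (blockRadius a P i)

/-- The summary of the block `i`. -/
def blockSummary (i : ℕ) : Summary M :=
  ⟨(blockSet a P i).card, blockRadius a P i, blockCover a P i⟩

/-- The global radius. -/
def globalRadius : ℝ :=
  √((∑ i ∈ Finset.range a.L, ((blockSet a P i).card : ℝ) * blockRadius a P i ^ 2) /
    (∑ i ∈ Finset.range a.L, (blockSet a P i).card : ℕ))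

/-- The union of the first-level covers. -/
def unionCover : M →₀ ℕ := ∑ i ∈ Finset.range a.L, blockCover a P i

/-- The centers computed on the union of the first-level covers. -/
def unionCenters : Finset M := a.seqWKMeans.run (unionCover a P, a.k')

/-- The second-level cover. -/
def secondCover : M →₀ ℕ :=
  coverWithBalls a.selC (unionCover a P) (unionCenters a P) a.δ (globalRadius a P)

/-- The weighted set computed by the second round from the block `i`. -/
def blockCoreset (i : ℕ) : M →₀ ℕ :=
  coverWithBalls (a.sel₂ i) (unitWeights (blockSet a P i)) (secondCover a P).support a.δ
    (globalRadius a P)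

/-- The weighted set gathered by the third round. -/
def coreset : M →₀ ℕ := ∑ i ∈ Finset.range a.L, blockCoreset a P i

lemma round1_mapped : (round1 a).mapped (input P) = P.val.map fun p => (a.block p, p) := by
  simp [Round.mapped, input, round1]

lemma round1_group (i : ℕ) : (round1 a).group (input P) i = (blockSet a P i).val := by
  rw [Round.group, round1_mapped, Multiset.filter_map, Multiset.map_map]
  simp [blockSet]

lemma round1_reduce (i : ℕ) : (round1 a).reduce i (blockSet a P i).val =
    ((blockSet a P i).val.map (fun p => (i, Sum.inl p)) + {(i, Sum.inr (blockSummary a P i))},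
      a.seqKMeans.space (blockSet a P i, a.k') + (blockCenters a P i).card +
        coverSpace (unitWeights (blockSet a P i)) (blockCenters a P i) (blockCover a P i)) := by
  simp only [round1, Finset.val_toFinset]
  rfl

variable {a P}

/-- A reducer exists only for a key that occurs, so an empty block would produce no summary. -/
lemma round1_keys (hne : ∀ i < a.L, (blockSet a P i).Nonempty) (hlt : ∀ p ∈ P, a.block p < a.L) :
    (round1 a).keys (input P) = Finset.range a.L := by
  ext i
  rw [Round.mem_keys, round1_mapped, Finset.mem_range]
  constructor
  · rintro ⟨v, hv⟩
    obtain ⟨p, hp, h⟩ := Multiset.mem_map.1 hv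
    simp only [Prod.mk.injEq] at h
    exact h.1 ▸ hlt p hp
  · intro hi
    obtain ⟨p, hp⟩ := hne i hi
    obtain ⟨hpP, rfl⟩ := Finset.mem_filter.1 hp
    exact ⟨p, Multiset.mem_map.2 ⟨p, hpP, rfl⟩⟩

lemma afterRound1_eq (hne : ∀ i < a.L, (blockSet a P i).Nonempty)
    (hlt : ∀ p ∈ P, a.block p < a.L) :
    afterRound1 a P = ∑ i ∈ Finset.range a.L, ((blockSet a P i).val.map (fun p => (i, Sum.inl p)) +
      {(i, Sum.inr (blockSummary a P i))}) := by
  rw [afterRound1, Round.run, round1_keys hne hlt]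
  refine Finset.sum_congr rfl fun i _ => ?_
  rw [round1_group, round1_reduce]

variable (a P)

lemma round2_mapped_block (j : ℕ) :
    (round2 a).mapped ((blockSet a P j).val.map (fun p => (j, Sum.inl p)) +
      {(j, Sum.inr (blockSummary a P j))}) =
    (blockSet a P j).val.map (fun p => (j, Sum.inl p)) +
      (Multiset.range a.L).map fun i => (i, Sum.inr (blockSummary a P j)) := by
  simp [Round.mapped, round2, Multiset.bind_map]

lemma round2_group_block (j i : ℕ) (hi : i < a.L) :
    (round2 a).group ((blockSet a P j).val.map (fun p => (j, Sum.inl p)) +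
      {(j, Sum.inr (blockSummary a P j))}) i =
    (if j = i then (blockSet a P j).val.map Sum.inl else 0) +
      {Sum.inr (blockSummary a P j)} := by
  rw [Round.group, round2_mapped_block, Multiset.filter_add, Multiset.map_add,
    Multiset.filter_map, Multiset.filter_map]
  congr 1
  · split_ifs with h <;> simp [h]
  · have h : (Multiset.range a.L).filter (fun x => x = i) = {i} := by
      rw [Multiset.filter_eq', Multiset.count_eq_one_of_mem (Multiset.nodup_range _)
        (Multiset.mem_range.2 hi)]
      rfl
    simp [h]

variable {a P}

lemma round2_group (hne : ∀ i < a.L, (blockSet a P i).Nonempty)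
    (hlt : ∀ p ∈ P, a.block p < a.L) {i : ℕ} (hi : i < a.L) :
    (round2 a).group (afterRound1 a P) i = (blockSet a P i).val.map Sum.inl +
      (Finset.range a.L).val.map fun j => Sum.inr (blockSummary a P j) := by
  rw [afterRound1_eq hne hlt, Round.group_sum,
    Finset.sum_congr rfl fun j _ => round2_group_block a P j i hi, Finset.sum_add_distrib,
    Finset.sum_ite_eq', if_pos (Finset.mem_range.2 hi), sum_map_singleton]

lemma round2_keys (hne : ∀ i < a.L, (blockSet a P i).Nonempty)
    (hlt : ∀ p ∈ P, a.block p < a.L) :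
    (round2 a).keys (afterRound1 a P) = Finset.range a.L := by
  ext i
  rw [Round.mem_keys, afterRound1_eq hne hlt, Round.mapped_sum,
    Finset.sum_congr rfl fun j _ => round2_mapped_block a P j, Finset.mem_range]
  simp only [Multiset.mem_sum, Multiset.mem_add, Multiset.mem_map, Finset.mem_range,
    Multiset.mem_range, Prod.mk.injEq]
  constructor
  · rintro ⟨v, j, hj, ⟨p, -, rfl, -⟩ | ⟨i', hi', rfl, -⟩⟩
    · exact hj
    · exact hi'
  · intro hi
    exact ⟨_, i, hi, Or.inr ⟨i, hi, rfl, rfl⟩⟩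

variable (a P)

lemma round2_reduce (i : ℕ) : (round2 a).reduce i ((blockSet a P i).val.map Sum.inl +
      (Finset.range a.L).val.map fun j => Sum.inr (blockSummary a P j)) =
    ((blockCoreset a P i).support.val.map (fun q => (0, (q, blockCoreset a P i q))),
      2 + wsetWords (unionCover a P) + a.seqWKMeans.space (unionCover a P, a.k') +
        (unionCenters a P).card + coverSpace (unionCover a P) (unionCenters a P) (secondCover a P) +
        coverSpace (unitWeights (blockSet a P i)) (secondCover a P).support
          (blockCoreset a P i)) := by
  have h1 : Multiset.filterMap Sum.getLeft? ((blockSet a P i).val.map Sum.inl +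
      (Finset.range a.L).val.map fun j => (Sum.inr (blockSummary a P j) : Msg M)) =
      (blockSet a P i).val := by
    rw [Multiset.filterMap_add, Multiset.filterMap_map, Multiset.filterMap_map]
    simp [Function.comp_def, filterMap_none_eq_zero]
  have h2 : Multiset.filterMap Sum.getRight? ((blockSet a P i).val.map Sum.inl +
      (Finset.range a.L).val.map fun j => (Sum.inr (blockSummary a P j) : Msg M)) =
      (Finset.range a.L).val.map (blockSummary a P) := by
    rw [Multiset.filterMap_add, Multiset.filterMap_map, Multiset.filterMap_map]
    simp only [Function.comp_def, Sum.getRight?_inl, Sum.getRight?_inr, filterMap_none_eq_zero,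
      zero_add]
    exact Multiset.filterMap_eq_map _ ▸ rfl
  simp only [round2, h1, h2, Finset.val_toFinset, Multiset.map_map]
  rfl

variable {a P}

lemma afterRound2_eq (hne : ∀ i < a.L, (blockSet a P i).Nonempty)
    (hlt : ∀ p ∈ P, a.block p < a.L) :
    afterRound2 a P = ∑ i ∈ Finset.range a.L,
      (blockCoreset a P i).support.val.map fun q => (0, (q, blockCoreset a P i q)) := by
  rw [afterRound2, Round.run, round2_keys hne hlt]
  refine Finset.sum_congr rfl fun i hi => ?_
  rw [round2_group hne hlt (Finset.mem_range.1 hi), round2_reduce]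

lemma round3_group (hne : ∀ i < a.L, (blockSet a P i).Nonempty)
    (hlt : ∀ p ∈ P, a.block p < a.L) :
    (round3 a).group (afterRound2 a P) 0 = ∑ i ∈ Finset.range a.L,
      (blockCoreset a P i).support.val.map fun q => (q, blockCoreset a P i q) := by
  rw [afterRound2_eq hne hlt, Round.group_sum]
  refine Finset.sum_congr rfl fun i _ => ?_
  rw [Round.group, Round.mapped]
  simp [round3, Multiset.bind_map, Multiset.filter_map]

/-- Positive total weight guarantees that some pair carries the key 0, so that the last reducer runs
at all. -/
lemma round3_keys (hne : ∀ i < a.L, (blockSet a P i).Nonempty)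
    (hlt : ∀ p ∈ P, a.block p < a.L) (hpos : 0 < totalWeight (coreset a P)) :
    (round3 a).keys (afterRound2 a P) = {0} := by
  ext i
  rw [Round.mem_keys, afterRound2_eq hne hlt, Round.mapped, Finset.mem_singleton]
  have hmap : (round3 a).map = fun x => {x} := rfl
  rw [hmap, Multiset.bind_singleton, Multiset.map_id']
  simp only [Multiset.mem_sum, Multiset.mem_map, Finset.mem_range, Prod.mk.injEq]
  constructor
  · rintro ⟨v, j, hj, p, -, rfl, -⟩
    rfl
  · rintro rfl
    have : coreset a P ≠ 0 := by
      intro h0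
      rw [h0] at hpos
      simp [totalWeight] at hpos
    obtain ⟨i, hi, hne⟩ := Finset.exists_ne_zero_of_sum_ne_zero this
    obtain ⟨q, hq⟩ := Finsupp.support_nonempty_iff.2 hne
    exact ⟨_, i, Finset.mem_range.1 hi, q, hq, rfl, rfl⟩

lemma round3_reduce (hne : ∀ i < a.L, (blockSet a P i).Nonempty)
    (hlt : ∀ p ∈ P, a.block p < a.L) :
    (round3 a).reduce 0 ((round3 a).group (afterRound2 a P) 0) =
    ((a.seqWKMeansOut.run (coreset a P, a.k, a.z)).val.map (fun p => (0, p)),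
      wsetWords (coreset a P) + a.seqWKMeansOut.space (coreset a P, a.k, a.z) +
        (a.seqWKMeansOut.run (coreset a P, a.k, a.z)).card) := by
  have h : (((round3 a).group (afterRound2 a P) 0).map
      fun x => Finsupp.single x.1 x.2).sum = coreset a P := by
    rw [round3_group hne hlt, ← Multiset.coe_mapAddMonoidHom, map_sum,
      ← Multiset.coe_sumAddMonoidHom, map_sum]
    refine Finset.sum_congr rfl fun i _ => ?_
    simp only [Multiset.coe_mapAddMonoidHom, Multiset.coe_sumAddMonoidHom, Multiset.map_map]
    exact Finsupp.sum_single (blockCoreset a P i)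
  simp only [round3] at h ⊢
  rw [h]

lemma solution_eq (hne : ∀ i < a.L, (blockSet a P i).Nonempty)
    (hlt : ∀ p ∈ P, a.block p < a.L) (hpos : 0 < totalWeight (coreset a P)) :
    solution a P = a.seqWKMeansOut.run (coreset a P, a.k, a.z) := by
  rw [solution, Round.run, round3_keys hne hlt hpos, Finset.sum_singleton, round3_reduce hne hlt]
  simp

end Execution

/-! ### Blocks of the partition -/

section Blocks

variable {M : Type*}

lemma blockSet_subset (a : Setup M) (P : Finset M) (i : ℕ) : blockSet a P i ⊆ P :=
  Finset.filter_subset _ _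

lemma mem_blockSet {a : Setup M} {P : Finset M} {p : M} (hp : p ∈ P) :
    p ∈ blockSet a P (a.block p) := Finset.mem_filter.2 ⟨hp, rfl⟩

lemma card_support_sum_le {ι : Type*} (s : Finset ι) (f : ι → M →₀ ℕ) :
    (∑ i ∈ s, f i).support.card ≤ ∑ i ∈ s, (f i).support.card :=
  (Finset.card_le_card Finsupp.support_finsetSum).trans Finset.card_biUnion_le

end Blocks

/-! ### Approximation guarantee and sizes of the covers -/

section Analysis

variable {M : Type*} [MetricSpace M]

/-- The facts about a setup on which the analysis rests. -/
structure IsRegular (a : Setup M) (P : Finset M) (β : ℝ) : Prop where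
  nonempty : P.Nonempty
  block_nonempty : ∀ i < a.L, (blockSet a P i).Nonempty
  block_lt : ∀ p ∈ P, a.block p < a.L
  δ_pos : 0 < a.δ
  δ_le : a.δ ≤ 1
  kMeans : IsKMeansApprox P β a.k' a.seqKMeans
  wKMeans : IsWKMeansApprox P β a.k' a.seqWKMeans

lemma blockRadius_nonneg (a : Setup M) (P : Finset M) (i : ℕ) : 0 ≤ blockRadius a P i :=
  Real.sqrt_nonneg _

lemma globalRadius_nonneg (a : Setup M) (P : Finset M) : 0 ≤ globalRadius a P :=
  Real.sqrt_nonneg _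

lemma distTo_sq_le_cost {Q S : Finset M} {p : M} (hp : p ∈ Q) : distTo p S ^ 2 ≤ cost Q S :=
  Finset.single_le_sum (f := fun p => distTo p S ^ 2) (fun _ _ => sq_nonneg _) hp

/-- Converts a bound by the total cost into the number `J` of rings. The square root is wasted: n ≤
2^J ≤ (2^J)² is enough. -/
lemma le_two_pow_mul {x R : ℝ} {n J : ℕ} (hR : 0 ≤ R) (hJ : n ≤ 2 ^ J)
    (h : x ^ 2 ≤ n * R ^ 2) : x ≤ 2 ^ J * R := by
  have h1 : (n : ℝ) ≤ 2 ^ J := by exact_mod_cast hJ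
  have h2 : (1 : ℝ) ≤ 2 ^ J := one_le_pow₀ one_le_two
  refine le_trans (le_abs_self x) (abs_le_of_sq_le_sq ?_ (by positivity))
  calc x ^ 2 ≤ n * R ^ 2 := h
    _ ≤ 2 ^ J * R ^ 2 := by gcongr
    _ ≤ (2 ^ J * 2 ^ J) * R ^ 2 := by
        gcongr
        nlinarith
    _ = _ := by ring

namespace IsRegular

variable {a : Setup M} {P : Finset M} {β : ℝ}

lemma sum_blocks (h : IsRegular a P β) {A : Type*} [AddCommMonoid A] (f : M → A) :
    ∑ i ∈ Finset.range a.L, ∑ p ∈ blockSet a P i, f p = ∑ p ∈ P, f p :=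
  Finset.sum_fiberwise_of_maps_to (fun p hp => Finset.mem_range.2 (h.block_lt p hp)) f

lemma sum_card_blocks (h : IsRegular a P β) :
    ∑ i ∈ Finset.range a.L, (blockSet a P i).card = P.card := by
  simp only [Finset.card_eq_sum_ones]
  exact h.sum_blocks fun _ => 1

lemma sum_blocks_block (h : IsRegular a P β) {A : Type*} [AddCommMonoid A] (f : ℕ → M → A) :
    ∑ i ∈ Finset.range a.L, ∑ p ∈ blockSet a P i, f i p = ∑ p ∈ P, f (a.block p) p := by
  rw [← h.sum_blocks]
  refine Finset.sum_congr rfl fun i _ => Finset.sum_congr rfl fun p hp => ?_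
  rw [(Finset.mem_filter.1 hp).2]

/-- Glues the proxy maps of the separate blocks into one map on `P`. -/
lemma push_blocks (h : IsRegular a P β) (π : ℕ → M → M) :
    ∑ i ∈ Finset.range a.L, push (blockSet a P i) (π i) = push P fun p => π (a.block p) p :=
  h.sum_blocks_block fun i p => Finsupp.single (π i p) 1

lemma blockCenters_spec (h : IsRegular a P β) {i : ℕ} (hi : i < a.L) :
    IsCenters (blockSet a P i) a.k' (blockCenters a P i) ∧
      cost (blockSet a P i) (blockCenters a P i) ≤ β * optKMeans a.k' (blockSet a P i) :=
  h.kMeans _ (blockSet_subset a P i) (h.block_nonempty i hi)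

lemma blockRadius_sq (h : IsRegular a P β) {i : ℕ} (hi : i < a.L) :
    ((blockSet a P i).card : ℝ) * blockRadius a P i ^ 2 =
      cost (blockSet a P i) (blockCenters a P i) := by
  have : ((blockSet a P i).card : ℝ) ≠ 0 := by
    exact_mod_cast (Finset.card_pos.2 (h.block_nonempty i hi)).ne'
  rw [blockRadius, Real.sq_sqrt (div_nonneg (cost_nonneg _ _) (by positivity))]
  field_simp

lemma globalRadius_sq (h : IsRegular a P β) :
    (P.card : ℝ) * globalRadius a P ^ 2 =
      ∑ i ∈ Finset.range a.L, cost (blockSet a P i) (blockCenters a P i) := by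
  have : (P.card : ℝ) ≠ 0 := by exact_mod_cast (Finset.card_pos.2 h.nonempty).ne'
  rw [globalRadius, h.sum_card_blocks,
    Real.sq_sqrt (div_nonneg (Finset.sum_nonneg fun _ _ => by positivity) (by positivity)),
    mul_div_cancel₀ _ this]
  exact Finset.sum_congr rfl fun i hi => h.blockRadius_sq (Finset.mem_range.1 hi)

lemma distTo_blockCenters_le (h : IsRegular a P β) {J : ℕ} (hJ : P.card ≤ 2 ^ J) {i : ℕ}
    (hi : i < a.L) {p : M} (hp : p ∈ blockSet a P i) :
    distTo p (blockCenters a P i) ≤ 2 ^ J * blockRadius a P i := by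
  refine le_two_pow_mul (blockRadius_nonneg a P i)
    ((Finset.card_le_card (blockSet_subset a P i)).trans hJ) ?_
  rw [h.blockRadius_sq hi]
  exact distTo_sq_le_cost hp

/-- The cost of one block is at most the sum over blocks, which is |P|R². Thus each block's own
centers serve as reference points at the global scale when the coreset is counted. -/
lemma distTo_blockCenters_le_global (h : IsRegular a P β) {J : ℕ} (hJ : P.card ≤ 2 ^ J) {i : ℕ}
    (hi : i < a.L) {p : M} (hp : p ∈ blockSet a P i) :
    distTo p (blockCenters a P i) ≤ 2 ^ J * globalRadius a P := by
  refine le_two_pow_mul (globalRadius_nonneg a P) hJ ?_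
  rw [h.globalRadius_sq]
  exact (distTo_sq_le_cost hp).trans
    (Finset.single_le_sum (f := fun i => cost (blockSet a P i) (blockCenters a P i))
      (fun _ _ => cost_nonneg _ _) (Finset.mem_range.2 hi))

/-- The same `X` competes on every block, with all k' centers allowed each time, so the block costs
add up to the cost on `P`. -/
lemma globalRadius_sq_le (h : IsRegular a P β) (hβ : 1 ≤ β) {X : Finset M} (hX : X.Nonempty)
    (hk : X.card ≤ a.k') : (P.card : ℝ) * globalRadius a P ^ 2 ≤ 4 * β * cost P X := by
  have hsum : cost P X = ∑ i ∈ Finset.range a.L, cost (blockSet a P i) X :=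
    (h.sum_blocks fun p => distTo p X ^ 2).symm
  rw [h.globalRadius_sq, hsum, Finset.mul_sum]
  refine Finset.sum_le_sum fun i hi => ?_
  rw [Finset.mem_range] at hi
  have := optKMeans_le_four_mul (h.block_nonempty i hi) hX hk
  calc _ ≤ β * optKMeans a.k' (blockSet a P i) := (h.blockCenters_spec hi).2
    _ ≤ β * (4 * cost (blockSet a P i) X) := by gcongr
    _ = _ := by ring

lemma blockCover_support_subset (h : IsRegular a P β) (i : ℕ) :
    (blockCover a P i).support ⊆ blockSet a P i := by
  obtain ⟨-, -, -, hs⟩ := coverWithBalls_unitWeights_spec (a.sel₁ i) (blockSet a P i)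
    (blockCenters a P i) h.δ_pos.le (blockRadius_nonneg a P i)
  exact hs

lemma blockCoreset_support_subset (h : IsRegular a P β) (i : ℕ) :
    (blockCoreset a P i).support ⊆ blockSet a P i := by
  obtain ⟨-, -, -, hs⟩ := coverWithBalls_unitWeights_spec (a.sel₂ i) (blockSet a P i)
    (secondCover a P).support h.δ_pos.le (globalRadius_nonneg a P)
  exact hs

lemma unionCover_spec (h : IsRegular a P β) : ∃ π : M → M,
    unionCover a P = push P π ∧
      ∑ p ∈ P, dist p (π p) ^ 2 ≤ 2 * a.δ ^ 2 * (P.card * globalRadius a P ^ 2) := by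
  choose π h1 h2 _ using fun i => coverWithBalls_unitWeights_spec (a.sel₁ i) (blockSet a P i)
    (blockCenters a P i) h.δ_pos.le (blockRadius_nonneg a P i)
  refine ⟨fun p => π (a.block p) p, ?_, ?_⟩
  · rw [← h.push_blocks]
    exact Finset.sum_congr rfl fun i _ => h2 i
  · rw [← h.sum_blocks_block fun i p => dist p (π i p) ^ 2, h.globalRadius_sq, Finset.mul_sum]
    refine Finset.sum_le_sum fun i hi => ?_
    rw [Finset.mem_range] at hi
    -- The terms |P_i|R_i² and cost(P_i, S_i) are equal, which gives the factor 2.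
    refine (sum_sq_le_of_le_max _ (fun _ _ => dist_nonneg) (h1 i)).trans (le_of_eq ?_)
    rw [h.blockRadius_sq hi, cost]
    ring

lemma unionCover_support_subset (h : IsRegular a P β) : (unionCover a P).support ⊆ P :=
  Finsupp.support_finsetSum.trans <| Finset.biUnion_subset.2 fun i _ =>
    (h.blockCover_support_subset i).trans (blockSet_subset a P i)

lemma unionCover_support_nonempty (h : IsRegular a P β) : (unionCover a P).support.Nonempty := by
  obtain ⟨π, hπ, -⟩ := h.unionCover_spec
  rw [hπ, support_push]
  exact h.nonempty.image π

lemma unionCenters_spec (h : IsRegular a P β) :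
    IsCenters (unionCover a P).support a.k' (unionCenters a P) ∧
      wcost (unionCover a P) (unionCenters a P) ≤ β * optWKMeans a.k' (unionCover a P) :=
  h.wKMeans _ h.unionCover_support_subset h.unionCover_support_nonempty

lemma secondCover_spec (h : IsRegular a P β) :
    (∀ c ∈ (unionCover a P).support, distTo c (secondCover a P).support ≤
      a.δ * max (globalRadius a P) (distTo c (unionCenters a P))) ∧
    (secondCover a P).support ⊆ (unionCover a P).support ∧ (secondCover a P).support.Nonempty ∧
    IsSeparated (secondCover a P).support (unionCenters a P) a.δ (globalRadius a P) := by
  obtain ⟨π, h1, -, h3, h4⟩ := coverWithBalls_spec a.selC (unionCover a P) (unionCenters a P)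
    h.δ_pos.le (globalRadius_nonneg a P)
  obtain ⟨c, hc⟩ := h.unionCover_support_nonempty
  exact ⟨fun c hc => (distTo_le_dist c (h1 c hc).1).trans (h1 c hc).2, h3, ⟨_, (h1 c hc).1⟩, h4⟩

lemma coreset_spec (h : IsRegular a P β) : ∃ π : M → M,
    coreset a P = push P π ∧ ∀ p ∈ P, dist p (π p) ≤
      a.δ * max (globalRadius a P) (distTo p (secondCover a P).support) := by
  choose π h1 h2 _ using fun i => coverWithBalls_unitWeights_spec (a.sel₂ i) (blockSet a P i)
    (secondCover a P).support h.δ_pos.le (globalRadius_nonneg a P)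
  refine ⟨fun p => π (a.block p) p, ?_, fun p hp => h1 _ p (mem_blockSet hp)⟩
  rw [← h.push_blocks]
  exact Finset.sum_congr rfl fun i _ => h2 i

lemma totalWeight_coreset (h : IsRegular a P β) : totalWeight (coreset a P) = P.card := by
  obtain ⟨π, hπ, -⟩ := h.coreset_spec
  rw [hπ, totalWeight_push]

lemma coreset_support_subset (h : IsRegular a P β) : (coreset a P).support ⊆ P :=
  Finsupp.support_finsetSum.trans <| Finset.biUnion_subset.2 fun i _ =>
    (h.blockCoreset_support_subset i).trans (blockSet_subset a P i)

lemma solution_eq_run (h : IsRegular a P β) :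
    solution a P = a.seqWKMeansOut.run (coreset a P, a.k, a.z) :=
  solution_eq h.block_nonempty h.block_lt
    (by rw [h.totalWeight_coreset]; exact Finset.card_pos.2 h.nonempty)

/-- The approximation guarantee. -/
lemma cost_solution_le (h : IsRegular a P β) {k z z' : ℕ} {α γ : ℝ} (hk : 0 < k)
    (hα : 0 < α) (hβ : 1 ≤ β) (hγ : 0 < γ) (hγ1 : γ ≤ 1 / 10) (hδ : 2 * β * a.δ ^ 2 = γ ^ 2)
    (hk' : k + z ≤ a.k')
    (hS : ∀ w', IsScaled (coreset a P) (solution a P) z' w' →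
      wcost w' (solution a P) ≤ α * optWOut k z (coreset a P))
    {Z : Finset M} (hZ : IsOut P (solution a P) z' Z) :
    cost (P \ Z) (solution a P) ≤ (α + 99 * (1 + α) * γ) * optOut k z P := by
  obtain ⟨S₀, Z₀, hS₀, hZ₀, hO⟩ := exists_optOut_eq k z h.nonempty hk
  have hX : (S₀ ∪ Z₀).Nonempty := hS₀.2.1.mono Finset.subset_union_left
  have hXk : (S₀ ∪ Z₀).card ≤ a.k' := by
    refine (Finset.card_union_le _ _).trans (le_trans ?_ hk')
    have := hS₀.2.2
    have := hZ₀.2.1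
    omega
  have hXO : cost P (S₀ ∪ Z₀) ≤ optOut k z P := hO ▸ cost_union_le P S₀ Z₀ hS₀.2.1
  have hR : (P.card : ℝ) * globalRadius a P ^ 2 ≤ 4 * β * optOut k z P :=
    (h.globalRadius_sq_le hβ hX hXk).trans (by gcongr)
  have hC' : cost P (secondCover a P).support ≤ optOut k z P := by
    obtain ⟨π, hπ, hπd⟩ := h.unionCover_spec
    have hSC := h.unionCenters_spec.2
    have hC := h.secondCover_spec.1
    rw [hπ] at hSC hC
    refine cost_cover_le h.nonempty hβ hγ hγ1 hδ hX hXk hXO hR (hπd.trans ?_) hSC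
      fun p hp => hC _ ?_
    -- Here 2δ²·4β = 4γ².
    · calc _ ≤ 2 * a.δ ^ 2 * (4 * β * optOut k z P) := by gcongr
        _ = 4 * γ ^ 2 * optOut k z P := by rw [← hδ]; ring
    · rw [support_push]
      exact Finset.mem_image_of_mem π hp
  obtain ⟨π, hπ, hπd⟩ := h.coreset_spec
  rw [hπ] at hS
  exact cost_sdiff_le_of_proxies hα hβ hγ hγ1 h.δ_pos.le (globalRadius_nonneg a P) hδ hS₀ hZ₀.1
    hZ₀.2.1 hO hR hC' hπd hS hZ

/-! ### Sizes of the covers -/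

lemma card_blockCover_le (h : IsRegular a P β) {D : ℝ} (hD : IsDoubling P D) {J : ℕ}
    (hJ0 : 0 < J) (hJ : P.card ≤ 2 ^ J) {i : ℕ} (hi : i < a.L) :
    ((blockCover a P i).support.card : ℝ) ≤ a.k' * (J * (8 / a.δ) ^ D) := by
  obtain ⟨-, -, -, -, hsep⟩ := coverWithBalls_spec (a.sel₁ i) (unitWeights (blockSet a P i))
    (blockCenters a P i) h.δ_pos.le (blockRadius_nonneg a P i)
  have hS := (h.blockCenters_spec hi).1
  have hδ := h.δ_pos
  refine (hsep.card_le hD h.δ_pos h.δ_le (blockRadius_nonneg a P i)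
    ((h.blockCover_support_subset i).trans (blockSet_subset a P i))
    (hS.1.trans (blockSet_subset a P i)) hJ0 fun y hy => ⟨h.distTo_blockCenters_le hJ hi
      (h.blockCover_support_subset i hy), exists_distTo_eq y hS.2.1⟩).trans ?_
  have : ((blockCenters a P i).card : ℝ) ≤ a.k' := by exact_mod_cast hS.2.2
  gcongr

lemma card_blockCoreset_le (h : IsRegular a P β) {D : ℝ} (hD : IsDoubling P D) {J : ℕ}
    (hJ0 : 0 < J) (hJ : P.card ≤ 2 ^ J) {i : ℕ} (hi : i < a.L) :
    ((blockCoreset a P i).support.card : ℝ) ≤ 3 * a.k' * J ^ 2 * ((8 / a.δ) ^ D) ^ 2 := by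
  obtain ⟨-, -, -, -, hsep⟩ := coverWithBalls_spec (a.sel₂ i) (unitWeights (blockSet a P i))
    (secondCover a P).support h.δ_pos.le (globalRadius_nonneg a P)
  have hS := (h.blockCenters_spec hi).1
  have hSC := h.unionCenters_spec.1
  obtain ⟨-, hC, hC0, hCsep⟩ := h.secondCover_spec
  refine card_le_of_separated_twice hD h.δ_pos h.δ_le (globalRadius_nonneg a P)
    ((h.blockCoreset_support_subset i).trans (blockSet_subset a P i))
    (hC.trans h.unionCover_support_subset) (hSC.1.trans h.unionCover_support_subset)
    (hS.1.trans (blockSet_subset a P i)) hC0 hSC.2.1 hSC.2.2 hS.2.2 hJ0 hsep hCsep fun p hp => ?_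
  obtain ⟨s, hs, hps⟩ := exists_distTo_eq p hS.2.1
  exact ⟨s, hs, hps ▸ h.distTo_blockCenters_le_global hJ hi
    (h.blockCoreset_support_subset i hp)⟩

lemma sum_card_le (h : IsRegular a P β) (f : ℕ → Finset M) (hf : ∀ i, f i ⊆ blockSet a P i) :
    ∑ i ∈ Finset.range a.L, (f i).card ≤ P.card := by
  rw [← h.sum_card_blocks]
  exact Finset.sum_le_sum fun i _ => Finset.card_le_card (hf i)

end IsRegular

/-! ### Memory -/

namespace IsRegular

variable {a : Setup M} {P : Finset M} {β : ℝ}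

lemma localMemory_round1_le (h : IsRegular a P β) {s W : ℝ} (hs : 0 ≤ s) (hW : 1 ≤ W)
    (hsp : HasLinearSpace a P s) (hm : ∀ i < a.L, ((blockSet a P i).card : ℝ) ≤ 2 * W) :
    ((round1 a).localMemory (input P) : ℝ) ≤ 49 * (1 + s) * W := by
  have hsW : 0 ≤ s * W := by positivity
  -- Local memory is a supremum of natural numbers, so the real bound is replaced by its floor
  -- before bounding each execution.
  rw [← Nat.le_floor_iff (by positivity)]
  refine Round.localMemory_le _ (fun x _ => ?_) fun i hi => ?_
  · refine Nat.le_floor ?_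
    have : (round1 a).mapMemory x = 4 := rfl
    rw [this]
    push_cast
    nlinarith
  · rw [round1_keys h.block_nonempty h.block_lt, Finset.mem_range] at hi
    refine Nat.le_floor ?_
    have hS : (blockCenters a P i).card ≤ (blockSet a P i).card :=
      Finset.card_le_card (h.blockCenters_spec hi).1.1
    have hC : (blockCover a P i).support.card ≤ (blockSet a P i).card :=
      Finset.card_le_card (h.blockCover_support_subset i)
    have hsp' := hsp.kMeans _ (blockSet_subset a P i) (h.block_nonempty i hi)
    have e : (round1 a).reduceMemory i (blockSet a P i).val = 1 + (blockSet a P i).card +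
        (a.seqKMeans.space (blockSet a P i, a.k') + (blockCenters a P i).card +
          (2 * (blockSet a P i).card + (blockCenters a P i).card + 2 +
            2 * (blockCover a P i).support.card)) +
        ((blockSet a P i).card * 2 + (1 + (2 + 2 * (blockCover a P i).support.card))) := by
      rw [Round.reduceMemory, round1_reduce]
      simp [round1, msgWords, coverSpace, wsetWords, support_unitWeights, blockSummary]
    rw [round1_group, e]
    have hS' : ((blockCenters a P i).card : ℝ) ≤ (blockSet a P i).card := by exact_mod_cast hS
    have hC' : ((blockCover a P i).support.card : ℝ) ≤ (blockSet a P i).card := by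
      exact_mod_cast hC
    have hm' := hm i hi
    have h1 : s * (blockSet a P i).card ≤ s * (2 * W) := by gcongr
    push_cast
    nlinarith

lemma localMemory_round2_le (h : IsRegular a P β) {s W : ℝ} (hs : 0 ≤ s) (hW : 1 ≤ W)
    (hsp : HasLinearSpace a P s) (hm : ∀ i < a.L, ((blockSet a P i).card : ℝ) ≤ 2 * W)
    (hL : (a.L : ℝ) ≤ 2 * W)
    (hLC : ∀ i < a.L, (a.L : ℝ) * (blockCover a P i).support.card ≤ 2 * W)
    (hC : ∑ i ∈ Finset.range a.L, ((blockCover a P i).support.card : ℝ) ≤ 2 * W) :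
    ((round2 a).localMemory (afterRound1 a P) : ℝ) ≤ 49 * (1 + s) * W := by
  have hsW : 0 ≤ s * W := by positivity
  rw [← Nat.le_floor_iff (by positivity)]
  refine Round.localMemory_le _ (fun x hx => ?_) fun i hi => ?_
  · rw [afterRound1_eq h.block_nonempty h.block_lt] at hx
    simp only [Multiset.mem_sum, Finset.mem_range, Multiset.mem_add, Multiset.mem_map,
      Multiset.mem_singleton] at hx
    refine Nat.le_floor ?_
    obtain ⟨j, hj, ⟨p, -, rfl⟩ | rfl⟩ := hx
    · have : (round2 a).mapMemory (j, Sum.inl p) = 4 := rfl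
      rw [this]
      push_cast
      nlinarith
    · have e : (round2 a).mapMemory (j, Sum.inr (blockSummary a P j)) =
          1 + (2 + 2 * (blockCover a P j).support.card) +
            a.L * (1 + (2 + 2 * (blockCover a P j).support.card)) := by
        simp [Round.mapMemory, round2, msgWords, wsetWords, blockSummary]
      rw [e]
      have h1 := hLC j hj
      have h2 : ((blockCover a P j).support.card : ℝ) ≤ 2 * W := by
        refine le_trans ?_ (hm j hj)
        exact_mod_cast Finset.card_le_card (h.blockCover_support_subset j)
      push_cast
      nlinarith
  · rw [round2_keys h.block_nonempty h.block_lt, Finset.mem_range] at hi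
    refine Nat.le_floor ?_
    have hSC : (unionCenters a P).card ≤ (unionCover a P).support.card :=
      Finset.card_le_card h.unionCenters_spec.1.1
    have hC2 : (secondCover a P).support.card ≤ (unionCover a P).support.card :=
      Finset.card_le_card h.secondCover_spec.2.1
    have hT : (blockCoreset a P i).support.card ≤ (blockSet a P i).card :=
      Finset.card_le_card (h.blockCoreset_support_subset i)
    have hsp' := hsp.wKMeans _ h.unionCover_support_subset h.unionCover_support_nonempty
    have hU : ((unionCover a P).support.card : ℝ) ≤ 2 * W := by
      refine le_trans ?_ hC
      exact_mod_cast card_support_sum_le _ _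
    have e : (round2 a).reduceMemory i ((round2 a).group (afterRound1 a P) i) =
        1 + ((blockSet a P i).card +
          (a.L * 2 + 2 * ∑ j ∈ Finset.range a.L, (blockCover a P j).support.card)) +
        (2 + 2 * (unionCover a P).support.card + a.seqWKMeans.space (unionCover a P, a.k') +
          (unionCenters a P).card +
          (2 * (unionCover a P).support.card + (unionCenters a P).card + 2 +
            2 * (secondCover a P).support.card) +
          (2 * (blockSet a P i).card + (secondCover a P).support.card + 2 +
            2 * (blockCoreset a P i).support.card)) +
        (blockCoreset a P i).support.card * 3 := by
      rw [round2_group h.block_nonempty h.block_lt hi, Round.reduceMemory, round2_reduce,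
        Multiset.map_add, Multiset.sum_add]
      have e2 : (((Finset.range a.L).val.map
          fun j => (Sum.inr (blockSummary a P j) : Msg M)).map (round2 a).midWords).sum =
          a.L * 2 + 2 * ∑ j ∈ Finset.range a.L, (blockCover a P j).support.card := by
        rw [Multiset.map_map]
        change ∑ j ∈ Finset.range a.L, (2 + 2 * (blockCover a P j).support.card) = _
        rw [Finset.sum_add_distrib, ← Finset.mul_sum]
        simp
      rw [e2]
      simp [round2, msgWords, coverSpace, wsetWords, support_unitWeights]
    rw [e]
    have hSC' : ((unionCenters a P).card : ℝ) ≤ (unionCover a P).support.card := by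
      exact_mod_cast hSC
    have hC2' : ((secondCover a P).support.card : ℝ) ≤ (unionCover a P).support.card := by
      exact_mod_cast hC2
    have hT' : ((blockCoreset a P i).support.card : ℝ) ≤ (blockSet a P i).card := by
      exact_mod_cast hT
    have hm' := hm i hi
    have h1 : s * (unionCover a P).support.card ≤ s * (2 * W) := by gcongr
    push_cast
    -- The size estimates give at most 42W + 7 words besides the 2sW of the subroutine; with W ≥ 1
    -- this is the source of the constant 49.
    nlinarith

lemma localMemory_round3_le (h : IsRegular a P β) {s W : ℝ} (hs : 0 ≤ s) (hW : 1 ≤ W)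
    (hsp : HasLinearSpace a P s) (hz : a.z < P.card)
    (hrun : a.seqWKMeansOut.run (coreset a P, a.k, a.z) ⊆ (coreset a P).support)
    (hT : ∑ i ∈ Finset.range a.L, ((blockCoreset a P i).support.card : ℝ) ≤ 6 * W) :
    ((round3 a).localMemory (afterRound2 a P) : ℝ) ≤ 49 * (1 + s) * W := by
  have hsW : 0 ≤ s * W := by positivity
  rw [← Nat.le_floor_iff (by positivity)]
  refine Round.localMemory_le _ (fun x _ => ?_) fun i hi => ?_
  · refine Nat.le_floor ?_
    have : (round3 a).mapMemory x = 6 := rfl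
    rw [this]
    push_cast
    nlinarith
  · rw [round3_keys h.block_nonempty h.block_lt
      (by rw [h.totalWeight_coreset]; exact Finset.card_pos.2 h.nonempty),
      Finset.mem_singleton] at hi
    subst hi
    refine Nat.le_floor ?_
    have hS : ((a.seqWKMeansOut.run (coreset a P, a.k, a.z)).card : ℝ) ≤
        (coreset a P).support.card := by exact_mod_cast Finset.card_le_card hrun
    have hsp' := hsp.wKMeansOut _ h.coreset_support_subset (by rwa [h.totalWeight_coreset])
    have hU : ((coreset a P).support.card : ℝ) ≤ 6 * W := by
      refine le_trans ?_ hT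
      exact_mod_cast card_support_sum_le _ _
    have e : (round3 a).reduceMemory 0 ((round3 a).group (afterRound2 a P) 0) =
        1 + (∑ j ∈ Finset.range a.L, (blockCoreset a P j).support.card) * 2 +
        (2 * (coreset a P).support.card + a.seqWKMeansOut.space (coreset a P, a.k, a.z) +
          (a.seqWKMeansOut.run (coreset a P, a.k, a.z)).card) +
        (a.seqWKMeansOut.run (coreset a P, a.k, a.z)).card * 2 := by
      have e2 : (((round3 a).group (afterRound2 a P) 0).map (round3 a).midWords).sum =
          (∑ j ∈ Finset.range a.L, (blockCoreset a P j).support.card) * 2 := by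
        have hmid : (round3 a).midWords = fun _ => 2 := rfl
        rw [hmid, Multiset.map_const', Multiset.sum_replicate, round3_group h.block_nonempty
          h.block_lt, Multiset.card_sum]
        simp
      rw [Round.reduceMemory, e2, round3_reduce h.block_nonempty h.block_lt]
      simp [round3, wsetWords]
    rw [e]
    have h1 : s * (coreset a P).support.card ≤ s * (6 * W) := by gcongr
    push_cast
    nlinarith

end IsRegular

end Analysis

/-! ### Choice of parameters and total memory -/

section Parameters

lemma natLog_succ_le_log {n : ℕ} (hn : 2 ≤ n) : ((Nat.log 2 n + 1 : ℕ) : ℝ) ≤ 3 * Real.log n := by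
  have h1 : 1 ≤ Nat.log 2 n := Nat.log_pos one_lt_two hn
  have h2 : (2 : ℝ) ^ Nat.log 2 n ≤ n := by exact_mod_cast Nat.pow_log_le_self 2 (by omega)
  have h3 := Real.log_le_log (by positivity) h2
  rw [Real.log_pow] at h3
  have h4 := Real.log_two_gt_d9
  have h5 : (1 : ℝ) ≤ Nat.log 2 n := by exact_mod_cast h1
  push_cast
  nlinarith

variable {M : Type*} [MetricSpace M] {a : Setup M} {P : Finset M} {β : ℝ}

/-- The bound for the local memory, in terms of `q = √(|P| / κ)`. -/
lemma IsRegular.localMemory_le (h : IsRegular a P β) {s κ q D : ℝ} {J : ℕ} (hs : 0 ≤ s)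
    (hsp : HasLinearSpace a P s) (hz : a.z < P.card)
    (hrun : a.seqWKMeansOut.run (coreset a P, a.k, a.z) ⊆ (coreset a P).support)
    (hD : IsDoubling P D) (hJ0 : 0 < J) (hJ : P.card ≤ 2 ^ J) (hq : 0 < q) (hκ : 1 ≤ κ)
    (hqκ : q ^ 2 * κ = P.card) (hL : a.L = ⌈q⌉₊) (hk' : (a.k' : ℝ) ≤ κ)
    (hb : ∀ i < a.L, (blockSet a P i).card ≤ (P.card + a.L - 1) / a.L) :
    (localMemory a P : ℝ) ≤ 49 * (1 + s) * (q * κ * ((8 / a.δ) ^ D) ^ 2 * J ^ 2) := by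
  set E := (8 / a.δ) ^ D with hE
  have hδ := h.δ_pos
  have hE1 : 1 ≤ E := Real.one_le_rpow (by rw [le_div_iff₀ hδ]; linarith [h.δ_le])
    (hD.nonneg h.nonempty)
  have hJ1 : (1 : ℝ) ≤ J := by exact_mod_cast hJ0
  have hn1 : (1 : ℝ) ≤ P.card := by exact_mod_cast Finset.card_pos.2 h.nonempty
  set N := q * κ with hN
  have hN1 : 1 ≤ N := by
    have : 1 ≤ N ^ 2 := by
      have : N ^ 2 = P.card * κ := by rw [hN, ← hqκ]; ring
      rw [this]
      nlinarith
    nlinarith [show 0 < N by positivity]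
  have hEJ : 1 ≤ E * J := by nlinarith
  have hNW : N * (E * J) ≤ N * E ^ 2 * J ^ 2 := by
    have : N * E ^ 2 * J ^ 2 = N * (E * J) * (E * J) := by ring
    rw [this]
    exact le_mul_of_one_le_right (by positivity) hEJ
  have hNW' : N ≤ N * E ^ 2 * J ^ 2 :=
    (le_mul_of_one_le_right (by positivity) hEJ).trans hNW
  set W := N * E ^ 2 * J ^ 2 with hWdef
  have hW : 1 ≤ W := hN1.trans hNW'
  have hLq : q ≤ a.L := hL ▸ Nat.le_ceil q
  have hL0 : 0 < a.L := hL ▸ Nat.ceil_pos.2 hq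
  -- As |P| = qN ≤ NL, a block has at most N + 1 ≤ 2N points, rounding included.
  have hm : ∀ i < a.L, ((blockSet a P i).card : ℝ) ≤ 2 * W := by
    intro i hi
    have h1 : (blockSet a P i).card * a.L ≤ P.card + a.L - 1 :=
      (Nat.le_div_iff_mul_le hL0).1 (hb i hi)
    have h2 : (blockSet a P i).card * a.L ≤ P.card + a.L := by omega
    have h3 : ((blockSet a P i).card : ℝ) * a.L ≤ P.card + a.L := by exact_mod_cast h2
    have h4 : ((blockSet a P i).card : ℝ) * a.L ≤ (N + 1) * a.L := by
      have : (P.card : ℝ) ≤ N * a.L := by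
        rw [← hqκ, hN]
        nlinarith [show 0 < q * κ by positivity]
      linarith
    have h5 := le_of_mul_le_mul_right h4 (by exact_mod_cast hL0)
    linarith
  -- If q < 1 then L = 1 and Lk' need not be O(N); but then |P| = qN ≤ N, and the trivial bound of
  -- every cover by |P| suffices.
  have hcases : (a.L * (a.k' : ℝ) ≤ 2 * N ∧ (a.L : ℝ) ≤ 2 * N) ∨
      ((a.L : ℝ) ≤ 1 ∧ (P.card : ℝ) ≤ N) := by
    rcases le_or_gt 1 q with h1 | h1
    · left
      have h2 : (a.L : ℝ) ≤ 2 * q := by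
        have := Nat.ceil_lt_add_one hq.le
        rw [← hL] at this
        linarith
      refine ⟨?_, h2.trans ?_⟩
      · calc a.L * (a.k' : ℝ) ≤ 2 * q * κ := by gcongr
          _ = 2 * N := by rw [hN]; ring
      · rw [hN]; nlinarith
    · right
      refine ⟨?_, ?_⟩
      · rw [hL]
        exact_mod_cast Nat.ceil_le.2 (by exact_mod_cast h1.le)
      · rw [← hqκ, hN]
        nlinarith [show 0 < q * κ by positivity]
  have hC : ∀ i < a.L, ((blockCover a P i).support.card : ℝ) ≤ a.k' * (J * E) :=
    fun i hi => h.card_blockCover_le hD hJ0 hJ hi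
  have hT : ∀ i < a.L, ((blockCoreset a P i).support.card : ℝ) ≤ 3 * a.k' * J ^ 2 * E ^ 2 :=
    fun i hi => h.card_blockCoreset_le hD hJ0 hJ hi
  have hLkC : a.L * (a.k' : ℝ) ≤ 2 * N → a.L * (a.k' * (J * E)) ≤ 2 * W := fun h1 =>
    calc a.L * (a.k' * (J * E)) = a.L * (a.k' : ℝ) * (J * E) := by ring
      _ ≤ 2 * N * (J * E) := by gcongr
      _ = 2 * (N * (E * J)) := by ring
      _ ≤ 2 * W := by gcongr
  have hL2 : (a.L : ℝ) ≤ 2 * W := by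
    rcases hcases with ⟨-, h1⟩ | ⟨h1, -⟩ <;> linarith
  have hLC : ∀ i < a.L, (a.L : ℝ) * (blockCover a P i).support.card ≤ 2 * W := by
    intro i hi
    rcases hcases with ⟨h1, -⟩ | ⟨h1, h2⟩
    · refine le_trans ?_ (hLkC h1)
      gcongr
      exact hC i hi
    · have h3 : ((blockCover a P i).support.card : ℝ) ≤ P.card := by
        exact_mod_cast Finset.card_le_card
          ((h.blockCover_support_subset i).trans (blockSet_subset a P i))
      calc (a.L : ℝ) * (blockCover a P i).support.card ≤ 1 * P.card := by gcongr
        _ ≤ 2 * W := by linarith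
  have hCsum : ∑ i ∈ Finset.range a.L, ((blockCover a P i).support.card : ℝ) ≤ 2 * W := by
    rcases hcases with ⟨h1, -⟩ | ⟨-, h2⟩
    · refine le_trans (Finset.sum_le_sum fun i hi => hC i (Finset.mem_range.1 hi)) ?_
      rw [Finset.sum_const, Finset.card_range, nsmul_eq_mul]
      exact hLkC h1
    · have h3 : ∑ i ∈ Finset.range a.L, ((blockCover a P i).support.card : ℝ) ≤ P.card := by
        exact_mod_cast h.sum_card_le _ h.blockCover_support_subset
      linarith
  have hTsum : ∑ i ∈ Finset.range a.L, ((blockCoreset a P i).support.card : ℝ) ≤ 6 * W := by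
    rcases hcases with ⟨h1, -⟩ | ⟨-, h2⟩
    · refine le_trans (Finset.sum_le_sum fun i hi => hT i (Finset.mem_range.1 hi)) ?_
      rw [Finset.sum_const, Finset.card_range, nsmul_eq_mul]
      calc a.L * (3 * a.k' * J ^ 2 * E ^ 2) = 3 * (a.L * (a.k' : ℝ)) * (J ^ 2 * E ^ 2) := by ring
        _ ≤ 3 * (2 * N) * (J ^ 2 * E ^ 2) := by gcongr
        _ = 6 * W := by rw [hWdef]; ring
    · have h3 : ∑ i ∈ Finset.range a.L, ((blockCoreset a P i).support.card : ℝ) ≤ P.card := by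
        exact_mod_cast h.sum_card_le _ h.blockCoreset_support_subset
      linarith
  rw [localMemory]
  push_cast
  exact max_le (h.localMemory_round1_le hs hW hsp hm)
    (max_le (h.localMemory_round2_le hs hW hsp hm hL2 hLC hCsum)
      (h.localMemory_round3_le hs hW hsp hz hrun hTsum))

end Parameters

end KMeansOutliers

end

theorem theorem3 :
    ∃ c₁ c₂ : ℝ, 0 < c₁ ∧ 0 < c₂ ∧
      ∀ (M : Type*) [MetricSpace M] (P : Finset M) (k z : ℕ) (ρ τ α β γ s : ℝ)
        (a : KMeansOutliers.Setup M),
        0 < k → k < P.card → z < P.card →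
        1 ≤ ρ → 1 ≤ τ → 0 < α → 1 ≤ β →
        0 < γ → γ ≤ (√3 - √2) / 6 →
        0 ≤ s →
        IsSetupFor a P ρ τ β γ k z →
        IsKMeansApprox P β a.k' a.seqKMeans →
        IsWKMeansApprox P β a.k' a.seqWKMeans →
        IsBicriteriaApprox P ρ τ α k z a.seqWKMeansOut →
        HasLinearSpace a P s →
        (solution a P ⊆ P ∧ (solution a P).Nonempty ∧ ((solution a P).card : ℝ) ≤ ρ * k) ∧
        (∀ Z : Finset M, IsOut P (solution a P) ⌊τ * z⌋₊ Z →
          cost (P \ Z) (solution a P) ≤ (α + c₁ * (1 + α) * γ) * optOut k z P) ∧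
        (KMeansOutliers.localMemory a P : ℝ) ≤
          c₂ * (1 + s) * ((P.card : ℝ) ^ (1 / 2 : ℝ) * (ρ * k + τ * z) ^ (1 / 2 : ℝ) *
            (8 * √(2 * β) / γ) ^ (2 * doublingDim P) * Real.log (P.card : ℝ) ^ 2) := by
  -- 441 = 49·3², the 3 coming from log₂|P| + 1 ≤ 3 log |P|.
  refine ⟨99, 441, by norm_num, by norm_num, ?_⟩
  intro M _ P k z ρ τ α β γ s a hk hkP hzP hρ hτ hα hβ hγ hγ' hs hset hkm hwkm hbi hsp
  obtain ⟨hak, haz, hak', haδ, haL, hblt, hbe⟩ := hset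
  have hn2 : 2 ≤ P.card := by omega
  have hP : P.Nonempty := Finset.card_pos.1 (by omega)
  have hn2' : (2 : ℝ) ≤ P.card := by exact_mod_cast hn2
  have hk1 : (1 : ℝ) ≤ k := by exact_mod_cast hk
  have hz0 : (0 : ℝ) ≤ z := by positivity
  set κ := ρ * k + τ * z with hκdef
  have hκ : 1 ≤ κ := by nlinarith [mul_nonneg (by linarith : (0 : ℝ) ≤ τ) hz0]
  set q := √((P.card : ℝ) / κ) with hqdef
  have hq : 0 < q := Real.sqrt_pos.2 (by positivity)
  have hqκ : q ^ 2 * κ = P.card := by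
    rw [hqdef, Real.sq_sqrt (by positivity)]
    field_simp
  -- (2 − 1.4)/6 = 1/10.
  have hγ1 : γ ≤ 1 / 10 := by
    have h3 : √3 ≤ 2 := Real.sqrt_le_iff.2 ⟨by norm_num, by norm_num⟩
    have h2 : (1.4 : ℝ) ≤ √2 := Real.le_sqrt_of_sq_le (by norm_num)
    linarith
  have h2β : 1 ≤ √(2 * β) := Real.one_le_sqrt.2 (by linarith)
  have hδ0 : 0 < a.δ := by rw [haδ]; positivity
  have hδ1 : a.δ ≤ 1 := by
    rw [haδ, div_le_one (by positivity)]
    linarith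
  have hδ2 : 2 * β * a.δ ^ 2 = γ ^ 2 := by
    rw [haδ, div_pow, Real.sq_sqrt (by linarith)]
    field_simp
  -- At most |P| blocks, so the rounded-down block size is at least 1 and no block is empty.
  have hLn : a.L ≤ P.card := by
    rw [haL, Nat.ceil_le, hqdef]
    refine Real.sqrt_le_iff.2 ⟨by positivity, ?_⟩
    rw [div_le_iff₀ (by positivity)]
    nlinarith [mul_nonneg (sq_nonneg (P.card : ℝ)) (by linarith : (0 : ℝ) ≤ κ - 1)]
  have hL0 : 0 < a.L := haL ▸ Nat.ceil_pos.2 hq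
  have h : IsRegular a P β :=
    { nonempty := hP
      block_nonempty := fun i hi => Finset.card_pos.1
        ((Nat.div_pos hLn hL0).trans_le (hbe i hi).1)
      block_lt := hblt
      δ_pos := hδ0
      δ_le := hδ1
      kMeans := hkm
      wKMeans := hwkm }
  have hrun := hbi _ h.coreset_support_subset (by rwa [h.totalWeight_coreset])
  rw [← hak, ← haz, ← h.solution_eq_run] at hrun
  obtain ⟨⟨hsub, hne, hcard⟩, hcost⟩ := hrun
  refine ⟨⟨hsub.trans h.coreset_support_subset, hne, ?_⟩, ?_, ?_⟩
  · rw [← hak]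
    exact (Nat.cast_le.2 hcard).trans (Nat.floor_le (by positivity))
  · intro Z hZ
    rw [← haz] at hZ
    rw [← hak, ← haz]
    refine h.cost_solution_le (hak ▸ hk) hα hβ hγ hγ1 hδ2 ?_ hcost hZ
    rw [hak', hak, haz]
    -- k ≤ ⌊ρk⌋ and z ≤ ⌊τz⌋ because ρ, τ ≥ 1: rounding leaves enough centers for the k optimal ones
    -- and the z outliers.
    refine add_le_add (Nat.le_floor ?_) (Nat.le_floor ?_) <;> nlinarith
  · have hk' : (a.k' : ℝ) ≤ κ := by
      rw [hak']
      push_cast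
      exact add_le_add (Nat.floor_le (by positivity)) (Nat.floor_le (by positivity))
    have hmem := h.localMemory_le hs hsp (haz ▸ hzP) (h.solution_eq_run ▸ hsub)
      (isDoubling_doublingDim P) (Nat.succ_pos (Nat.log 2 P.card))
      (Nat.lt_pow_succ_log_self one_lt_two _).le hq hκ hqκ haL hk' fun i hi => (hbe i hi).2
    have hlog := natLog_succ_le_log hn2
    have e1 : (P.card : ℝ) ^ (1 / 2 : ℝ) * κ ^ (1 / 2 : ℝ) = q * κ := by
      rw [← Real.sqrt_eq_rpow, ← Real.sqrt_eq_rpow, ← hqκ, Real.sqrt_mul (by positivity),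
        Real.sqrt_sq hq.le, mul_assoc, Real.mul_self_sqrt (by positivity)]
    have e2 : (8 * √(2 * β) / γ) ^ (2 * doublingDim P) = ((8 / a.δ) ^ doublingDim P) ^ 2 := by
      have : 8 / a.δ = 8 * √(2 * β) / γ := by rw [haδ]; field_simp
      rw [this, mul_comm 2 (doublingDim P), Real.rpow_mul (by positivity), Real.rpow_two]
    rw [e1, e2]
    refine hmem.trans ?_
    calc 49 * (1 + s) * (q * κ * ((8 / a.δ) ^ doublingDim P) ^ 2 *
          ((Nat.log 2 P.card + 1 : ℕ) : ℝ) ^ 2)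
        ≤ 49 * (1 + s) * (q * κ * ((8 / a.δ) ^ doublingDim P) ^ 2 *
          (3 * Real.log P.card) ^ 2) := by gcongr
      _ = _ := by ring
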